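/- Let $\theta\neq 2$ be a Pisot number, i.e. a real algebraic integer $\theta>1$ all of whose other conjugates over $\mathbb{Q}$ have modulus less than $1$ (the integers $\theta\ge 3$ are included). Let $\mu_\theta$ be the Bernoulli convolution with parameter $\theta$, i.e. the infinite convolution of the probability measures $\tfrac12\delta_{-\theta^{-k}}+\tfrac12\delta_{\theta^{-k}}$, $k=0,1,2,\dots$, on $\mathbb{R}$ (equivalently, the law of $\sum_{k\ge 0}\pm\theta^{-k}$ with independent fair signs), and let $$\widehat{\mu_\theta}(t)=\int_{\mathbb{R}}e^{2\pi i t x}\,d\mu_\theta(x),\qquad t\in\mathbb{R}.$$ Let $r\in\mathbb{Q}(\theta)$, $r\neq 0$, and for $\gamma\in\mathbb{R}$ put $$E_\gamma=\{\widehat{\mu_\theta}(nr)\,e^{2\pi i\gamma n}: n\in\mathbb{Z}\}\subset\mathbb{C}.$$ Then: 1. for every $\gamma\in\mathbb{Q}(\theta)$ the closure $\overline{E_\gamma}$ is (at most) countable; 2. there is a radius $\rho>0$ (depending on $\theta$ and $r$ only) such that for Lebesgue-almost every $\gamma\in\mathbb{R}$ the closure $\overline{E_\gamma}$ contains the circle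 $\{z\in\mathbb{C}:|z|=\rho\}$; in particular $\overline{E_\gamma}$ is uncountable for Lebesgue-almost every $\gamma$. -/

import Mathlib

open MeasureTheory
open scoped ENNReal

/-- A Pisot number: a real algebraic integer `θ > 1` all of whose other complex conjugates
(the complex roots of its minimal polynomial over `ℚ`) have modulus less than `1`. -/
def IsPisot (θ : ℝ) : Prop :=
  1 < θ ∧ IsIntegral ℤ θ ∧
    ∀ z : ℂ, Polynomial.aeval z (minpoly ℚ θ) = 0 → z ≠ (θ : ℂ) → ‖z‖ < 1

/-- The symmetric two-point measure `½ δ_{-a} + ½ δ_a` on the real line. -/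
noncomputable def symmetricTwoPoint (a : ℝ) : Measure ℝ :=
  (2⁻¹ : ℝ≥0∞) • Measure.dirac (-a) + (2⁻¹ : ℝ≥0∞) • Measure.dirac a

/-- The Bernoulli convolution with parameter `θ`, that is, the infinite convolution of the
measures `½ δ_{-θ⁻ᵏ} + ½ δ_{θ⁻ᵏ}`, `k = 0, 1, 2, …`: the law of the sum `∑ₖ xₖ` of independent
random variables `xₖ`, where `xₖ` takes the values `± θ⁻ᵏ` with probability `½` each. For `θ > 1`
the series converges absolutely with probability one. -/
noncomputable def bernoulliConvolution (θ : ℝ) : Measure ℝ :=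
  (Measure.infinitePi fun k : ℕ => symmetricTwoPoint (θ⁻¹ ^ k)).map fun x => ∑' k, x k

/-- The Fourier transform `t ↦ ∫ e^{2π i t x} dν(x)` of a measure on the real line. -/
noncomputable def fourierTransform (ν : Measure ℝ) (t : ℝ) : ℂ :=
  ∫ x, Complex.exp (2 * Real.pi * t * x * Complex.I) ∂ν

/-- The set `{μ̂_θ(n r) e^{2π i γ n} : n ∈ ℤ}`. -/
noncomputable def translatedCoefficients (θ r γ : ℝ) : Set ℂ :=
  Set.range fun n : ℤ =>
    fourierTransform (bernoulliConvolution θ) (n * r) *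
      Complex.exp (2 * Real.pi * Complex.I * γ * n)

open Filter Topology ProbabilityTheory

/-! Write b = 1/θ. The transform at t is the product of cos(2πt b^k), k ≥ 0, so up to sign it
depends only on the residues u_k of 2t b^k modulo 1. An integer polynomial P with P(b) = 0, acting
through the shift, sends such residues to integers. The other conjugates of b lie outside the closed
unit disc, so a bounded sequence killed by P on a half-line is geometric there with ratio b
(`exists_shiftAct_kernel`).

Countability. The transform is at most exp(-2 ∑ u_k²) in modulus, so near a nonzero limit point the
residue sequences are bounded in ℓ². Along an ultrafilter they converge pointwise to some v, and the
remainder u - v escapes to +∞. It splits into finitely many bubbles, translates of two-sided ℓ²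
sequences with integral P-action, each carrying a fixed amount of ℓ² mass; the cosine product is
asymptotically multiplicative over this splitting (`exists_tendsto_cosProd`). Integers tending to 0
are eventually 0, so only countably many v and bubbles exist. For γ in ℚ(θ) the phase e^{2πiγn} is,
up to a root of unity of bounded order, a continuous function of finitely many residues, hence its
limit is determined by v and that root of unity.

Circle. By a trace argument, an algebraic integer of ℚ(θ) times θ^k is exponentially close to an
integer. Hence the modulus of the transform at Mθ^K has a nonzero limit, provided M avoids every
zero of the cosine factors; this is where θ ≠ 2 enters (`IsPisot.exists_forall_cos_ne_zero`).
Integers n_j close to Mθ^j/r then give, along a subsequence, coefficients at n_j r tending to some z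
≠ 0. For almost every γ the phases e^{2πiγ n_j} accumulate at every point of the unit circle
(`ae_forall_mapClusterPt_exp`), so ρ = |z| works. -/

/-! ### The transform as an infinite product of cosines -/

instance isProbabilityMeasure_symmetricTwoPoint (a : ℝ) :
    IsProbabilityMeasure (symmetricTwoPoint a) := by
  constructor
  simp [symmetricTwoPoint, ENNReal.inv_two_add_inv_two]

lemma ae_symmetricTwoPoint (a : ℝ) : ∀ᵐ x ∂(symmetricTwoPoint a), ‖x‖ ≤ |a| := by
  have hs : MeasurableSet {x : ℝ | ‖x‖ ≤ |a|} := measurableSet_le measurable_norm measurable_const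
  rw [symmetricTwoPoint, ae_add_measure_iff]
  exact ⟨Measure.ae_smul_measure ((ae_dirac_iff hs).2 (by simp)) _,
    Measure.ae_smul_measure ((ae_dirac_iff hs).2 (by simp)) _⟩

lemma integral_exp_symmetricTwoPoint (a t : ℝ) :
    ∫ x, Complex.exp (2 * Real.pi * t * x * Complex.I) ∂(symmetricTwoPoint a) =
      (Real.cos (2 * Real.pi * t * a) : ℂ) := by
  have h2 : (2⁻¹ : ℝ≥0∞) ≠ ∞ := by simp
  have hi : ∀ b : ℝ, Integrable (fun x : ℝ => Complex.exp (2 * Real.pi * t * x * Complex.I))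
      ((2⁻¹ : ℝ≥0∞) • Measure.dirac b) := fun b =>
    Integrable.smul_measure (integrable_dirac (by simp)) h2
  rw [symmetricTwoPoint, integral_add_measure (hi _) (hi _), integral_smul_measure,
    integral_smul_measure, integral_dirac, integral_dirac, Complex.ofReal_cos, Complex.cos]
  simp
  ring_nf

lemma ae_summable_bernoulli {θ : ℝ} (hθ : 1 < θ) :
    ∀ᵐ x : ℕ → ℝ ∂(Measure.infinitePi fun k : ℕ => symmetricTwoPoint (θ⁻¹ ^ k)), Summable x := by
  have h : ∀ᵐ x : ℕ → ℝ ∂(Measure.infinitePi fun k : ℕ => symmetricTwoPoint (θ⁻¹ ^ k)),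
      ∀ k, ‖x k‖ ≤ |θ⁻¹ ^ k| := by
    rw [ae_all_iff]
    intro k
    exact (measurePreserving_eval_infinitePi
      (fun k : ℕ => symmetricTwoPoint (θ⁻¹ ^ k)) k).quasiMeasurePreserving.ae
      (ae_symmetricTwoPoint (θ⁻¹ ^ k))
  filter_upwards [h] with x hx
  refine Summable.of_norm_bounded (summable_geometric_of_lt_one (r := θ⁻¹) (by positivity)
    (inv_lt_one_of_one_lt₀ hθ)) fun k => (hx k).trans_eq ?_
  exact abs_of_nonneg (by positivity)

/-- The Fourier transform of the Bernoulli convolution is an infinite product of cosines. -/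
theorem tendsto_prod_cos_fourierTransform {θ : ℝ} (hθ : 1 < θ) (t : ℝ) :
    Tendsto (fun N : ℕ => ((∏ k ∈ Finset.range N, Real.cos (2 * Real.pi * t * θ⁻¹ ^ k) : ℝ) : ℂ))
      atTop (𝓝 (fourierTransform (bernoulliConvolution θ) t)) := by
  set P := Measure.infinitePi fun k : ℕ => symmetricTwoPoint (θ⁻¹ ^ k) with hP
  have hlim : ∀ᵐ x ∂P, Tendsto (fun N => ∑ k ∈ Finset.range N, x k) atTop (𝓝 (∑' k, x k)) := by
    filter_upwards [ae_summable_bernoulli hθ] with x hx using hx.hasSum.tendsto_sum_nat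
  have hmeas : ∀ N : ℕ, Measurable fun x : ℕ → ℝ => ∑ k ∈ Finset.range N, x k := fun N => by
    fun_prop
  -- The sum takes the default value 0 where the series diverges; only almost everywhere is it a
  -- limit of partial sums, which suffices for `integral_map`.
  have hae : AEMeasurable (fun x : ℕ → ℝ => ∑' k, x k) P :=
    aemeasurable_of_tendsto_metrizable_ae atTop (fun N => (hmeas N).aemeasurable) hlim
  have hcont : Continuous fun x : ℝ => Complex.exp (2 * Real.pi * t * x * Complex.I) := by
    fun_prop
  rw [fourierTransform, bernoulliConvolution, integral_map hae
    hcont.aestronglyMeasurable]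
  have key : ∀ N : ℕ, ∫ x, Complex.exp (2 * Real.pi * t *
      ((∑ k ∈ Finset.range N, x k : ℝ) : ℂ) * Complex.I) ∂P =
      ((∏ k ∈ Finset.range N, Real.cos (2 * Real.pi * t * θ⁻¹ ^ k) : ℝ) : ℂ) := by
    intro N
    have hind : iIndepFun (fun (k : ℕ) (x : ℕ → ℝ) => x k) P :=
      iIndepFun_infinitePi (P := fun k : ℕ => symmetricTwoPoint (θ⁻¹ ^ k))
        (X := fun _ x => x) (fun _ => measurable_id)
    have hind' : iIndepFun (fun (k : Fin N) (x : ℕ → ℝ) => x k) P :=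
      hind.precomp Fin.val_injective
    have := hind'.integral_fun_prod_comp (f := fun _ (y : ℝ) =>
      Complex.exp (2 * Real.pi * t * y * Complex.I))
      (fun k => (measurable_pi_apply _).aemeasurable) (fun k => hcont.aestronglyMeasurable)
    rw [Complex.ofReal_prod, Finset.prod_range]
    simp_rw [← integral_exp_symmetricTwoPoint]
    rw [show (∏ i : Fin N, ∫ x, Complex.exp (2 * Real.pi * t * x * Complex.I)
      ∂(symmetricTwoPoint (θ⁻¹ ^ (i : ℕ)))) = ∏ i : Fin N, ∫ x : ℕ → ℝ,
        Complex.exp (2 * Real.pi * t * (x i : ℝ) * Complex.I) ∂P from ?_, ← this]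
    · congr 1
      ext x
      rw [← Complex.exp_sum, Finset.sum_range, Complex.ofReal_sum, Finset.mul_sum, Finset.sum_mul]
    · refine Finset.prod_congr rfl fun i _ => ?_
      rw [← Measure.infinitePi_map_eval (fun k : ℕ => symmetricTwoPoint (θ⁻¹ ^ k)) (i : ℕ),
        integral_map (measurable_pi_apply _).aemeasurable hcont.aestronglyMeasurable]
  simp_rw [← key]
  refine tendsto_integral_of_dominated_convergence (fun _ => (1 : ℝ)) (fun N => ?_)
    (integrable_const _) (fun N => ?_) ?_
  · exact (hcont.measurable.comp (hmeas N)).aestronglyMeasurable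
  · refine Eventually.of_forall fun x => le_of_eq ?_
    rw [show 2 * (Real.pi : ℂ) * t * ((∑ k ∈ Finset.range N, x k : ℝ) : ℂ) =
      ((2 * Real.pi * t * ∑ k ∈ Finset.range N, x k : ℝ) : ℂ) by push_cast; ring]
    exact Complex.norm_exp_ofReal_mul_I _
  · filter_upwards [hlim] with x hx using (hcont.tendsto _).comp hx

/-! ### Integer recurrences and their bounded solutions -/

open Polynomial in
/-- The action of an integer polynomial on two-sided real sequences, with `X` acting as the
shift. -/
noncomputable def shiftAct (p : ℤ[X]) (u : ℤ → ℝ) (k : ℤ) : ℝ :=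
  ∑ i ∈ Finset.range (p.natDegree + 1), (p.coeff i : ℝ) * u (k + i)

section Kernel

open Polynomial

/-- The shift on complex sequences. -/
noncomputable def seqShift : Module.End ℂ (ℕ → ℂ) := LinearMap.funLeft ℂ ℂ Nat.succ

lemma seqShift_pow_apply (i : ℕ) (v : ℕ → ℂ) (k : ℕ) : (seqShift ^ i) v k = v (k + i) := by
  induction i generalizing k with
  | zero => simp
  | succ i ih =>
    rw [pow_succ', Module.End.mul_apply]
    change (seqShift ^ i) v (k + 1) = _
    rw [ih]
    congr 1
    omega

lemma aeval_seqShift_apply (Q : ℂ[X]) (v : ℕ → ℂ) (k : ℕ) :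
    aeval seqShift Q v k = ∑ i ∈ Finset.range (Q.natDegree + 1), Q.coeff i * v (k + i) := by
  rw [aeval_eq_sum_range, LinearMap.sum_apply, Finset.sum_apply]
  simp [seqShift_pow_apply]

lemma norm_shift_sub_le {v : ℕ → ℂ} {C : ℝ} (hb : ∀ k, ‖v k‖ ≤ C) (z : ℂ) (k : ℕ) :
    ‖(aeval seqShift (X - Polynomial.C z : ℂ[X]) v) k‖ ≤ C + ‖z‖ * C := by
  have : (aeval seqShift (X - Polynomial.C z : ℂ[X]) v) k = v (k + 1) - z * v k := by
    simp [seqShift, LinearMap.funLeft]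
  rw [this]
  refine (norm_sub_le _ _).trans (add_le_add (hb _) ?_)
  rw [norm_mul]
  exact mul_le_mul_of_nonneg_left (hb _) (norm_nonneg _)

lemma eq_zero_of_shift_eq_smul {v : ℕ → ℂ} {C : ℝ} (hb : ∀ k, ‖v k‖ ≤ C) {z : ℂ} (hz : 1 < ‖z‖)
    (h : aeval seqShift (X - Polynomial.C z : ℂ[X]) v = 0) : v = 0 := by
  have hstep : ∀ k, v (k + 1) = z * v k := fun k => by
    have := congrFun h k
    simpa [seqShift, LinearMap.funLeft, sub_eq_zero] using this
  funext k
  by_contra hne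
  have hpow : ∀ m, ‖v (k + m)‖ = ‖z‖ ^ m * ‖v k‖ := by
    intro m
    induction m with
    | zero => simp
    | succ m ih => rw [← add_assoc, hstep, norm_mul, ih]; ring
  have hpos : 0 < ‖v k‖ := norm_pos_iff.2 hne
  obtain ⟨m, hm⟩ := pow_unbounded_of_one_lt (C / ‖v k‖) hz
  rw [div_lt_iff₀ hpos, ← hpow] at hm
  exact absurd (hb (k + m)) (not_le.2 hm)

/-- Linear factors are peeled off one at a time: applying X - z keeps a sequence bounded, and a
bounded geometric sequence of ratio z with |z| > 1 vanishes. -/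
lemma eq_zero_of_bounded_of_aeval_seqShift (n : ℕ) : ∀ (Q : ℂ[X]), Q.natDegree = n → Q ≠ 0 →
    (∀ z, Q.IsRoot z → 1 < ‖z‖) → ∀ (v : ℕ → ℂ) (C : ℝ), (∀ k, ‖v k‖ ≤ C) →
      aeval seqShift Q v = 0 → v = 0 := by
  induction n with
  | zero =>
    intro Q hn hQ _ v C _ h
    rw [eq_C_of_natDegree_eq_zero hn] at h hQ
    have hc : Q.coeff 0 ≠ 0 := by simpa using hQ
    simpa [hc] using h
  | succ n ih =>
    intro Q hn hQ hr v C hb h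
    have hdeg : Q.degree ≠ 0 := by
      intro h0
      have := natDegree_eq_zero_iff_degree_le_zero.2 h0.le
      omega
    obtain ⟨z, hz⟩ := IsAlgClosed.exists_root Q hdeg
    obtain ⟨Q', rfl⟩ := dvd_iff_isRoot.2 hz
    have hQ' : Q' ≠ 0 := right_ne_zero_of_mul hQ
    refine eq_zero_of_shift_eq_smul hb (hr z hz) ?_
    refine ih Q' ?_ hQ' (fun w hw => hr w ?_) _ _ (norm_shift_sub_le hb z) ?_
    · rw [natDegree_mul (X_sub_C_ne_zero z) hQ', natDegree_X_sub_C] at hn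
      omega
    · simp only [IsRoot.def, eval_mul] at hw ⊢
      rw [hw, mul_zero]
    · rw [← Module.End.mul_apply, ← map_mul, mul_comm]
      exact h

/-- A bounded solution of a linear recurrence, one of whose characteristic roots is simple and
all of whose other characteristic roots lie outside the closed unit disc, is geometric. -/
lemma geometric_of_bounded_of_aeval_seqShift {Q : ℂ[X]} (hsep : Q.Separable) {a : ℂ}
    (ha : Q.IsRoot a) (hr : ∀ z, Q.IsRoot z → z ≠ a → 1 < ‖z‖) {v : ℕ → ℂ} {C : ℝ}
    (hb : ∀ k, ‖v k‖ ≤ C) (h : aeval seqShift Q v = 0) (k : ℕ) : v (k + 1) = a * v k := by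
  obtain ⟨Q', rfl⟩ := dvd_iff_isRoot.2 ha
  have hQ' : Q' ≠ 0 := right_ne_zero_of_mul hsep.ne_zero
  have hna : ¬ Q'.IsRoot a := by
    intro hQa
    obtain ⟨R, rfl⟩ := dvd_iff_isRoot.2 hQa
    have := hsep.squarefree (X - Polynomial.C a) ⟨R, by ring⟩
    exact not_isUnit_X_sub_C a this
  have h0 : aeval seqShift (X - Polynomial.C a : ℂ[X]) v = 0 := by
    refine eq_zero_of_bounded_of_aeval_seqShift _ Q' rfl hQ' (fun z hz => hr z ?_ ?_) _ _
      (norm_shift_sub_le hb a) ?_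
    · simp only [IsRoot.def, eval_mul] at hz ⊢
      rw [hz, mul_zero]
    · rintro rfl
      exact hna hz
    · rw [← Module.End.mul_apply, ← map_mul, mul_comm]
      exact h
  have := congrFun h0 k
  simpa [seqShift, LinearMap.funLeft, sub_eq_zero] using this

end Kernel

lemma shiftAct_sub (p : Polynomial ℤ) (u w : ℤ → ℝ) (k : ℤ) :
    shiftAct p (fun m => u m - w m) k = shiftAct p u k - shiftAct p w k := by
  simp [shiftAct, mul_sub, Finset.sum_sub_distrib]

lemma shiftAct_translate (p : Polynomial ℤ) (u : ℤ → ℝ) (a k : ℤ) :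
    shiftAct p (fun m => u (m + a)) k = shiftAct p u (k + a) := by
  simp only [shiftAct]
  refine Finset.sum_congr rfl fun i _ => ?_
  rw [add_right_comm]

lemma shiftAct_geometric (p : Polynomial ℤ) {u : ℤ → ℝ} {c b : ℝ} {k : ℤ}
    (hu : ∀ i : ℕ, u (k + i) = c * b ^ i) : shiftAct p u k = c * Polynomial.aeval b p := by
  rw [shiftAct, Polynomial.aeval_eq_sum_range, Finset.mul_sum]
  refine Finset.sum_congr rfl fun i _ => ?_
  rw [hu, zsmul_eq_mul]
  ring

lemma abs_shiftAct_le (p : Polynomial ℤ) {u : ℤ → ℝ} {k : ℤ} {c : ℝ}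
    (hu : ∀ i : ℕ, |u (k + i)| ≤ c) :
    |shiftAct p u k| ≤ (∑ i ∈ Finset.range (p.natDegree + 1), |(p.coeff i : ℝ)|) * c := by
  rw [shiftAct, Finset.sum_mul]
  refine (Finset.abs_sum_le_sum_abs _ _).trans (Finset.sum_le_sum fun i _ => ?_)
  rw [abs_mul]
  exact mul_le_mul_of_nonneg_left (hu i) (abs_nonneg _)

lemma tendsto_shiftAct (p : Polynomial ℤ) {J : Type*} {F : Filter J} {u : J → ℤ → ℝ} {v : ℤ → ℝ}
    (h : ∀ k, Tendsto (fun j => u j k) F (𝓝 (v k))) (k : ℤ) :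
    Tendsto (fun j => shiftAct p (u j) k) F (𝓝 (shiftAct p v k)) :=
  tendsto_finsetSum _ fun _ _ => (h _).const_mul _

lemma exists_int_eq_shiftAct (p : Polynomial ℤ) (a : ℤ → ℤ) (k : ℤ) :
    ∃ m : ℤ, shiftAct p (fun i => a i) k = m :=
  ⟨∑ i ∈ Finset.range (p.natDegree + 1), p.coeff i * a (k + i), by simp [shiftAct]⟩

/-- The characteristic recurrence of `θ⁻¹`: an integer polynomial annihilating exactly the
geometric sequences of ratio `θ⁻¹` among bounded sequences. -/
lemma exists_shiftAct_kernel {θ : ℝ} (hθ : IsPisot θ) : ∃ P : Polynomial ℤ,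
    Polynomial.aeval θ⁻¹ P = 0 ∧ ∀ (u : ℤ → ℝ) (C : ℝ) (m : ℤ), (∀ k, |u k| ≤ C) →
      (∀ k, m ≤ k → shiftAct P u k = 0) → ∀ i : ℕ, u (m + i) = u m * θ⁻¹ ^ i := by
  obtain ⟨h1, hint, hconj⟩ := hθ
  have hθ0 : θ ≠ 0 := by positivity
  have hint' : IsIntegral ℚ θ := hint.tower_top
  have hinv : IsIntegral ℚ θ⁻¹ := hint'.inv
  set f := minpoly ℚ θ⁻¹ with hf
  obtain ⟨b, hb, hP⟩ := IsLocalization.integerNormalization_spec (nonZeroDivisors ℤ) f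
  set P := IsLocalization.integerNormalization (nonZeroDivisors ℤ) f
  have hb0 : b ≠ 0 := nonZeroDivisors.ne_zero hb
  refine ⟨P, IsLocalization.integerNormalization_aeval_eq_zero _ _ (minpoly.aeval ℚ θ⁻¹), ?_⟩
  intro u C m hu h
  set v : ℕ → ℂ := fun i => (u (m + i) : ℂ) with hv
  set Q : Polynomial ℂ := f.map (algebraMap ℚ ℂ) with hQ
  have hPQ : ∀ i, ((P.coeff i : ℝ) : ℂ) = b * Q.coeff i := fun i => by
    have := congrArg (fun g : Polynomial ℚ => algebraMap ℚ ℂ (g.coeff i)) hP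
    simpa [hQ] using this
  have hdeg : P.natDegree = Q.natDegree := by
    have h1 : (P.map (algebraMap ℤ ℚ)).natDegree = P.natDegree :=
      Polynomial.natDegree_map_eq_of_injective (by exact Int.cast_injective) _
    have h2 : (b • f).natDegree = f.natDegree := by
      rw [Polynomial.natDegree_smul _ hb0]
    rw [← h1, hP, h2, hQ, Polynomial.natDegree_map]
  have hann : Polynomial.aeval seqShift Q v = 0 := by
    funext k
    have hk := h (m + k) (by omega)
    rw [aeval_seqShift_apply, ← hdeg]
    have : (b : ℂ) * ∑ i ∈ Finset.range (P.natDegree + 1), Q.coeff i * v (k + i) = 0 := by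
      rw [Finset.mul_sum, ← Complex.ofReal_zero, ← hk, shiftAct, Complex.ofReal_sum]
      refine Finset.sum_congr rfl fun i _ => ?_
      rw [Complex.ofReal_mul, hPQ, hv, mul_assoc]
      push_cast
      rw [add_assoc]
    simpa [hb0] using this
  have hsep : Q.Separable := (minpoly.irreducible hinv).separable.map
  have hroot : ∀ z, Q.IsRoot z ↔ Polynomial.aeval z f = 0 := fun z => by
    rw [hQ, Polynomial.IsRoot.def, Polynomial.eval_map_algebraMap]
  have ha : Q.IsRoot ((θ⁻¹ : ℝ) : ℂ) := by
    rw [hroot, show ((θ⁻¹ : ℝ) : ℂ) = algebraMap ℝ ℂ θ⁻¹ from rfl,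
      Polynomial.aeval_algebraMap_apply, minpoly.aeval, map_zero]
  have hrest : ∀ z, Q.IsRoot z → z ≠ ((θ⁻¹ : ℝ) : ℂ) → 1 < ‖z‖ := by
    intro z hz hne
    rw [hroot] at hz
    -- The roots of f are thereby inverses of conjugates of θ, which the Pisot condition places
    -- outside the closed disc.
    have hdvd : f ∣ (minpoly ℚ θ).reverse := by
      refine minpoly.dvd _ _ ?_
      let : Invertible θ := invertibleOfNonzero hθ0
      rw [← invOf_eq_inv, Polynomial.aeval_def, Polynomial.eval₂_reverse_eq_zero_iff,
        ← Polynomial.aeval_def, minpoly.aeval]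
    have hz0 : z ≠ 0 := by
      rintro rfl
      rw [Polynomial.aeval_def, Polynomial.eval₂_at_zero] at hz
      exact minpoly.coeff_zero_ne_zero hinv (inv_ne_zero hθ0) (by simpa using hz)
    have hzr : Polynomial.aeval z⁻¹ (minpoly ℚ θ) = 0 := by
      have h2 : Polynomial.aeval z (minpoly ℚ θ).reverse = 0 := by
        obtain ⟨g, hg⟩ := hdvd
        rw [hg, map_mul, hz, zero_mul]
      let : Invertible z⁻¹ := invertibleOfNonzero (inv_ne_zero hz0)
      rw [Polynomial.aeval_def, ← Polynomial.eval₂_reverse_eq_zero_iff, invOf_eq_inv, inv_inv]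
      exact h2
    have := hconj _ hzr (fun heq => hne (by rw [Complex.ofReal_inv, ← heq, inv_inv]))
    rw [norm_inv] at this
    exact (inv_lt_one₀ (norm_pos_iff.2 hz0)).1 this
  intro i
  induction i with
  | zero => simp
  | succ i ih =>
    have := geometric_of_bounded_of_aeval_seqShift hsep ha hrest (v := v) (C := C)
      (fun k => by simpa [hv] using hu (m + k)) hann i
    simp only [hv] at this
    rw [pow_succ', mul_left_comm, ← ih]
    exact_mod_cast this

/-! ### Cosine products over square-summable sequences -/

section Products

variable {ι : Type*}

lemma abs_prod_sub_prod_le {a b : ι → ℝ} (ha : ∀ i, |a i| ≤ 1) (hb : ∀ i, |b i| ≤ 1)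
    (s : Finset ι) : |∏ i ∈ s, a i - ∏ i ∈ s, b i| ≤ ∑ i ∈ s, |a i - b i| := by
  classical
  induction s using Finset.induction_on with
  | empty => simp
  | insert i s hi ih =>
    rw [Finset.prod_insert hi, Finset.prod_insert hi, Finset.sum_insert hi]
    have hp : |∏ i ∈ s, a i| ≤ 1 := by
      rw [Finset.abs_prod]
      exact Finset.prod_le_one (fun _ _ => abs_nonneg _) fun j _ => ha j
    calc |a i * ∏ i ∈ s, a i - b i * ∏ i ∈ s, b i|
        = |(a i - b i) * ∏ i ∈ s, a i + b i * (∏ i ∈ s, a i - ∏ i ∈ s, b i)| := by ring_nf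
      _ ≤ |a i - b i| * |∏ i ∈ s, a i| + |b i| * |∏ i ∈ s, a i - ∏ i ∈ s, b i| := by
        rw [← abs_mul, ← abs_mul]
        exact abs_add_le _ _
      _ ≤ |a i - b i| * 1 + 1 * |∏ i ∈ s, a i - ∏ i ∈ s, b i| := by
        gcongr
        exact hb i
      _ ≤ _ := by linarith

lemma abs_tprod_sub_tprod_le {a b : ι → ℝ} (ha : ∀ i, |a i| ≤ 1) (hb : ∀ i, |b i| ≤ 1)
    (hma : Multipliable a) (hmb : Multipliable b) (hs : Summable fun i => |a i - b i|) :
    |∏' i, a i - ∏' i, b i| ≤ ∑' i, |a i - b i| :=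
  le_of_tendsto ((hma.hasProd.sub hmb.hasProd).abs) (Eventually.of_forall fun s =>
    (abs_prod_sub_prod_le ha hb s).trans (hs.sum_le_tsum s fun _ _ => abs_nonneg _))

lemma abs_cos_sub_one_le (x : ℝ) : |Real.cos x - 1| ≤ x ^ 2 / 2 := by
  rw [abs_le]
  constructor
  · linarith [Real.one_sub_sq_div_two_le_cos (x := x)]
  · nlinarith [Real.cos_le_one x, sq_nonneg x]

lemma multipliable_cos {u : ι → ℝ} (hu : Summable fun i => u i ^ 2) :
    Multipliable fun i => Real.cos (Real.pi * u i) := by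
  have h : Summable fun i => ‖Real.cos (Real.pi * u i) - 1‖ := by
    refine Summable.of_nonneg_of_le (fun _ => norm_nonneg _) (fun i => ?_)
      (hu.mul_left (Real.pi ^ 2 / 2))
    exact (abs_cos_sub_one_le _).trans_eq (by ring)
  simpa using multipliable_one_add_of_summable h

end Products

/-- The product `∏ cos (π u_k)` over a two-sided sequence. -/
noncomputable def cosProd (u : ℤ → ℝ) : ℝ := ∏' k, Real.cos (Real.pi * u k)

lemma cosProd_translate (u : ℤ → ℝ) (a : ℤ) : cosProd (fun k => u (k + a)) = cosProd u :=
  (Equiv.addRight a).tprod_eq fun k => Real.cos (Real.pi * u k)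

lemma summable_sq_translate {u : ℤ → ℝ} (hu : Summable fun k => u k ^ 2) (a : ℤ) :
    Summable fun k => u (k + a) ^ 2 :=
  (Equiv.addRight a).summable_iff.2 hu

lemma tsum_sq_translate (u : ℤ → ℝ) (a : ℤ) : ∑' k, u (k + a) ^ 2 = ∑' k, u k ^ 2 :=
  (Equiv.addRight a).tsum_eq fun k => u k ^ 2

lemma summable_abs_mul {u w : ℤ → ℝ} (hu : Summable fun k => u k ^ 2)
    (hw : Summable fun k => w k ^ 2) : Summable fun k => |u k| * |w k| := by
  refine Summable.of_nonneg_of_le (fun _ => by positivity) (fun k => ?_) (hu.add hw)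
  nlinarith [sq_nonneg (|u k| - |w k|), sq_abs (u k), sq_abs (w k), sq_nonneg (u k),
    sq_nonneg (w k)]

lemma summable_sq_sub {u w : ℤ → ℝ} (hu : Summable fun k => u k ^ 2)
    (hw : Summable fun k => w k ^ 2) : Summable fun k => (u k - w k) ^ 2 := by
  refine Summable.of_nonneg_of_le (fun _ => by positivity) (fun k => ?_)
    ((hu.add hw).mul_left 2)
  nlinarith [sq_nonneg (u k + w k)]

lemma sq_le_tsum_sq {u : ℤ → ℝ} (hu : Summable fun k => u k ^ 2) (k : ℤ) :
    u k ^ 2 ≤ ∑' k, u k ^ 2 :=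
  hu.le_tsum k fun _ _ => sq_nonneg _

lemma abs_cosProd_sub_one_le {u : ℤ → ℝ} (hu : Summable fun k => u k ^ 2) :
    |cosProd u - 1| ≤ Real.pi ^ 2 / 2 * ∑' k, u k ^ 2 := by
  have hle : ∀ k, |Real.cos (Real.pi * u k) - 1| ≤ Real.pi ^ 2 / 2 * u k ^ 2 := fun k =>
    (abs_cos_sub_one_le _).trans_eq (by ring)
  have hs : Summable fun k => |Real.cos (Real.pi * u k) - 1| :=
    Summable.of_nonneg_of_le (fun _ => abs_nonneg _) hle (hu.mul_left _)
  have := abs_tprod_sub_tprod_le (b := fun _ : ℤ => (1 : ℝ)) (fun k => Real.abs_cos_le_one _)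
    (fun _ => by simp) (multipliable_cos hu) multipliable_one hs
  rw [tprod_one] at this
  refine this.trans ?_
  rw [← tsum_mul_left]
  exact hs.tsum_le_tsum hle (hu.mul_left _)

/-- The product of cosines is nearly multiplicative on sums of nearly orthogonal sequences. -/
lemma abs_cosProd_sub_mul_le {u w : ℤ → ℝ} (hu : Summable fun k => u k ^ 2)
    (hw : Summable fun k => w k ^ 2) :
    |cosProd u - cosProd w * cosProd (fun k => u k - w k)| ≤
      Real.pi ^ 2 * ∑' k, |w k| * |u k - w k| := by
  have hd := summable_sq_sub hu hw
  have hm := (multipliable_cos hw).mul (multipliable_cos hd)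
  have hle : ∀ k, |Real.cos (Real.pi * u k) -
      Real.cos (Real.pi * w k) * Real.cos (Real.pi * (u k - w k))| ≤
      Real.pi ^ 2 * (|w k| * |u k - w k|) := by
    intro k
    have : Real.cos (Real.pi * u k) -
        Real.cos (Real.pi * w k) * Real.cos (Real.pi * (u k - w k)) =
        -(Real.sin (Real.pi * w k) * Real.sin (Real.pi * (u k - w k))) := by
      rw [show Real.pi * u k = Real.pi * w k + Real.pi * (u k - w k) by ring, Real.cos_add]
      ring
    rw [this, abs_neg, abs_mul]
    calc _ ≤ |Real.pi * w k| * |Real.pi * (u k - w k)| :=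
          mul_le_mul Real.abs_sin_le_abs Real.abs_sin_le_abs (abs_nonneg _) (abs_nonneg _)
      _ = _ := by
        rw [abs_mul, abs_mul, abs_of_pos Real.pi_pos]
        ring
  have hsum := (summable_abs_mul hw hd).mul_left (Real.pi ^ 2)
  have hs := Summable.of_nonneg_of_le (fun _ => abs_nonneg _) hle hsum
  have := abs_tprod_sub_tprod_le (fun k => Real.abs_cos_le_one _) (fun k => by
    rw [abs_mul]
    exact mul_le_one₀ (Real.abs_cos_le_one _) (abs_nonneg _) (Real.abs_cos_le_one _))
    (multipliable_cos hu) hm hs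
  rw [(multipliable_cos hw).tprod_mul (multipliable_cos hd)] at this
  refine this.trans ?_
  rw [← tsum_mul_left]
  exact hs.tsum_le_tsum hle hsum

/-- Pythagoras with an error term: removing w from u lowers the mass by that of w, up to the same
cross term that controls `abs_cosProd_sub_mul_le`. -/
lemma tsum_sq_sub_le {u w : ℤ → ℝ} (hu : Summable fun k => u k ^ 2)
    (hw : Summable fun k => w k ^ 2) :
    ∑' k, (u k - w k) ^ 2 ≤
      ∑' k, u k ^ 2 - ∑' k, w k ^ 2 + 2 * ∑' k, |w k| * |u k - w k| := by
  have hd := summable_sq_sub hu hw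
  have hm := summable_abs_mul hw hd
  rw [← tsum_mul_left, ← hu.tsum_sub hw, ← (hu.sub hw).tsum_add (hm.mul_left 2)]
  refine hd.tsum_le_tsum (fun k => ?_) ((hu.sub hw).add (hm.mul_left 2))
  have := neg_abs_le (w k * (u k - w k))
  rw [abs_mul] at this
  nlinarith

/-! ### Weak limits along filters -/

section Limits

variable {J : Type*} {F : Filter J}

/-- A bounded sequence in ℓ² tending to 0 pointwise becomes orthogonal to a fixed w, even with
absolute values. The part of |w||D| exceeding ηD² is dominated by w²/η, so dominated convergence
applies; the rest costs at most ηE. -/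
lemma tendsto_tsum_abs_mul {w : ℤ → ℝ} (hw : Summable fun k => w k ^ 2) {D : J → ℤ → ℝ} {E : ℝ}
    (hD : ∀ j, Summable fun k => D j k ^ 2) (hE : ∀ᶠ j in F, ∑' k, D j k ^ 2 ≤ E)
    (h : ∀ k, Tendsto (fun j => D j k) F (𝓝 0)) :
    Tendsto (fun j => ∑' k, |w k| * |D j k|) F (𝓝 0) := by
  rw [Metric.tendsto_nhds]
  intro ε hε
  set η : ℝ := ε / (2 * (|E| + 1)) with hη
  have hη0 : 0 < η := by positivity
  have hlim : Tendsto (fun j => ∑' k, max 0 (|w k| * |D j k| - η * D j k ^ 2)) F (𝓝 0) := by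
    have := tendsto_tsum_of_dominated_convergence (𝓕 := F)
      (f := fun j k => max 0 (|w k| * |D j k| - η * D j k ^ 2)) (g := fun _ => (0 : ℝ))
      (bound := fun k => η⁻¹ * w k ^ 2) (hw.mul_left _) (fun k => ?_)
      (Eventually.of_forall fun j k => ?_)
    · simpa using this
    · have h1 := ((h k).abs.const_mul |w k|).sub (((h k).pow 2).const_mul η)
      simpa using (tendsto_const_nhds (x := (0 : ℝ))).max h1
    · rw [Real.norm_eq_abs, abs_of_nonneg (le_max_left _ _), max_le_iff]
      refine ⟨by positivity, ?_⟩
      rw [inv_mul_eq_div, le_div_iff₀ hη0]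
      rw [← sq_abs (w k), ← sq_abs (D j k)]
      have h1 : 0 ≤ |w k| * (η * |D j k|) := by positivity
      nlinarith [sq_nonneg (|w k| - η * |D j k|)]
  filter_upwards [hE, (Metric.tendsto_nhds.1 hlim) (ε / 2) (half_pos hε)] with j hj1 hj2
  have hm := summable_abs_mul hw (hD j)
  have hmax : Summable fun k => max 0 (|w k| * |D j k| - η * D j k ^ 2) :=
    Summable.of_nonneg_of_le (fun _ => le_max_left _ _) (fun k => max_le (by positivity)
      (sub_le_self _ (by positivity))) hm
  have hle : ∑' k, |w k| * |D j k| ≤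
      ∑' k, max 0 (|w k| * |D j k| - η * D j k ^ 2) + η * ∑' k, D j k ^ 2 := by
    rw [← tsum_mul_left, ← hmax.tsum_add ((hD j).mul_left η)]
    refine hm.tsum_le_tsum (fun k => ?_) (hmax.add ((hD j).mul_left η))
    linarith [le_max_right 0 (|w k| * |D j k| - η * D j k ^ 2)]
  rw [Real.dist_eq, sub_zero] at hj2 ⊢
  rw [abs_of_nonneg (tsum_nonneg fun _ => by positivity)]
  have h1 : η * ∑' k, D j k ^ 2 ≤ η * (|E| + 1) :=
    mul_le_mul_of_nonneg_left (by linarith [le_abs_self E]) hη0.le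
  have h2 : η * (|E| + 1) = ε / 2 := by
    rw [hη]
    field_simp
  linarith [(abs_lt.1 hj2).2]

lemma summable_sq_of_tendsto [F.NeBot] {u : J → ℤ → ℝ} {v : ℤ → ℝ} {E : ℝ}
    (hu : ∀ j, Summable fun k => u j k ^ 2) (hE : ∀ᶠ j in F, ∑' k, u j k ^ 2 ≤ E)
    (h : ∀ k, Tendsto (fun j => u j k) F (𝓝 (v k))) : Summable fun k => v k ^ 2 := by
  refine summable_of_sum_le (c := E) (fun _ => sq_nonneg _) fun s => ?_
  refine le_of_tendsto (tendsto_finsetSum s fun k _ => (h k).pow 2) ?_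
  filter_upwards [hE] with j hj
  exact ((hu j).sum_le_tsum s fun _ _ => sq_nonneg _).trans hj

lemma exists_int_of_tendsto [F.NeBot] {f : J → ℝ} {x : ℝ} (h : Tendsto f F (𝓝 x))
    (hf : ∀ᶠ j in F, ∃ m : ℤ, f j = m) : ∃ m : ℤ, x = m := by
  have := Int.isClosedEmbedding_coe_real.isClosed_range.mem_of_tendsto h
    (hf.mono fun j ⟨m, hm⟩ => ⟨m, hm.symm⟩)
  obtain ⟨m, hm⟩ := this
  exact ⟨m, hm.symm⟩

lemma Ultrafilter.exists_tendsto_of_abs_le {F : Ultrafilter J} {f : J → ℝ} {C : ℝ}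
    (h : ∀ᶠ j in F, |f j| ≤ C) : ∃ x, Tendsto f F (𝓝 x) := by
  have hle : ((F.map f : Ultrafilter ℝ) : Filter ℝ) ≤ 𝓟 (Set.Icc (-C) C) := by
    rw [le_principal_iff]
    exact h.mono fun j hj => abs_le.1 hj
  obtain ⟨x, -, hx⟩ := isCompact_Icc.ultrafilter_le_nhds (F.map f) hle
  exact ⟨x, hx⟩

end Limits

/-! ### Countability of sequences with integral action -/

lemma tendsto_shiftAct_cofinite (p : Polynomial ℤ) {u : ℤ → ℝ} (hu : Summable fun k => u k ^ 2) :
    Tendsto (shiftAct p u) cofinite (𝓝 0) := by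
  have h0 : Tendsto u cofinite (𝓝 0) := by
    have := hu.tendsto_cofinite_zero.sqrt
    simp only [Real.sqrt_sq_eq_abs, Real.sqrt_zero] at this
    exact (tendsto_zero_iff_abs_tendsto_zero _).2 this
  have : Tendsto (fun k => shiftAct p u k) cofinite
      (𝓝 (∑ i ∈ Finset.range (p.natDegree + 1), (p.coeff i : ℝ) * 0)) :=
    tendsto_finsetSum _ fun i _ =>
      (h0.comp (add_left_injective (i : ℤ)).tendsto_cofinite).const_mul _
  simpa using this

/-- The P-action of an ℓ² sequence tends to 0, so integral values have finite support, leaving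
countably many possibilities. The integer from p at 0 pins down what P alone misses on a half-line.
-/
lemma countable_of_shiftAct_int (P p : Polynomial ℤ) (s : Set ℤ) (A : Set (ℤ → ℝ))
    (hsum : ∀ u ∈ A, Summable fun k => u k ^ 2)
    (hP : ∀ u ∈ A, ∀ k ∈ s, ∃ m : ℤ, shiftAct P u k = m)
    (hp : ∀ u ∈ A, ∃ m : ℤ, shiftAct p u 0 = m)
    (hinj : ∀ u ∈ A, ∀ v ∈ A, (∀ k ∈ s, shiftAct P u k = shiftAct P v k) →
      shiftAct p u 0 = shiftAct p v 0 → u = v) : A.Countable := by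
  classical
  let g : (ℤ → ℝ) → (ℤ → ℤ) × ℤ := fun u =>
    (fun k => if k ∈ s then round (shiftAct P u k) else 0, round (shiftAct p u 0))
  refine Set.countable_of_injective_of_countable_image (f := g) ?_ ?_
  · intro u hu v hv huv
    refine hinj u hu v hv (fun k hk => ?_) ?_
    · have := congrFun (congrArg Prod.fst huv) k
      obtain ⟨m, hm⟩ := hP u hu k hk
      obtain ⟨m', hm'⟩ := hP v hv k hk
      simp only [g, hk, if_true, hm, hm', round_intCast] at this
      rw [hm, hm', this]
    · have := congrArg Prod.snd huv
      obtain ⟨m, hm⟩ := hp u hu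
      obtain ⟨m', hm'⟩ := hp v hv
      simp only [g, hm, hm', round_intCast] at this
      rw [hm, hm', this]
  · refine Set.Countable.mono (s₂ := Set.range fun x : (ℤ →₀ ℤ) × ℤ => ((x.1 : ℤ → ℤ), x.2)) ?_
      (Set.countable_range _)
    rintro _ ⟨u, hu, rfl⟩
    have hfin : (Function.support (g u).1).Finite := by
      have := (tendsto_shiftAct_cofinite P (hsum u hu)).abs
      rw [abs_zero] at this
      have h1 : ∀ᶠ k in cofinite, |shiftAct P u k| < 1 := this.eventually_lt_const one_pos
      refine Set.Finite.subset h1 fun k hk hlt => hk ?_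
      by_cases hks : k ∈ s
      · obtain ⟨m, hm⟩ := hP u hu k hks
        simp only [g, hks, if_true, hm, round_intCast]
        rw [Set.mem_ofPred_eq, hm] at hlt
        exact Int.abs_lt_one_iff.1 (by exact_mod_cast hlt)
      · simp [g, hks]
    exact ⟨(Finsupp.ofSupportFinite _ hfin, (g u).2), rfl⟩

/-- Square-summable two-sided sequences on which the integer polynomial `P` acts with integer
values. -/
def integralSeqs (P : Polynomial ℤ) : Set (ℤ → ℝ) :=
  {u | (Summable fun k => u k ^ 2) ∧ ∀ k, ∃ m : ℤ, shiftAct P u k = m}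

/-- The values of `cosProd` on `integralSeqs P`, closed under multiplication. -/
noncomputable def cosProdMonoid (P : Polynomial ℤ) : Submonoid ℝ :=
  Submonoid.closure (cosProd '' integralSeqs P)

/-- The property of `P` that bounded sequences annihilated by `P` on a half-line are geometric
with ratio `b`. -/
def HasGeometricKernel (P : Polynomial ℤ) (b : ℝ) : Prop :=
  ∀ (u : ℤ → ℝ) (C : ℝ) (m : ℤ), (∀ k, |u k| ≤ C) →
    (∀ k, m ≤ k → shiftAct P u k = 0) → ∀ i : ℕ, u (m + i) = u m * b ^ i

lemma abs_le_sqrt_tsum_sq {u : ℤ → ℝ} (hu : Summable fun k => u k ^ 2) (k : ℤ) :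
    |u k| ≤ √(∑' k, u k ^ 2) :=
  Real.abs_le_sqrt (sq_le_tsum_sq hu k)

/-- A difference killed by P on all of ℤ is geometric from every starting point. Starting at k - i
with i → ∞, boundedness forces the value at k to be 0. -/
lemma integralSeqs_countable {P : Polynomial ℤ} {b : ℝ} (hP : HasGeometricKernel P b)
    (hb0 : 0 < b) (hb1 : b < 1) : (integralSeqs P).Countable := by
  refine countable_of_shiftAct_int P P Set.univ _ (fun u hu => hu.1) (fun u hu k _ => hu.2 k)
    (fun u hu => hu.2 0) fun u hu v hv huv _ => ?_
  have hd := summable_sq_sub hu.1 hv.1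
  have hgeo := fun m => hP (fun k => u k - v k) _ m (abs_le_sqrt_tsum_sq hd) fun k _ => by
    rw [shiftAct_sub, huv k trivial, sub_self]
  funext k
  have hlim : Tendsto (fun i : ℕ => √(∑' k, (u k - v k) ^ 2) * b ^ i) atTop (𝓝 0) := by
    simpa using (tendsto_pow_atTop_nhds_zero_of_lt_one hb0.le hb1).const_mul
      (√(∑' k, (u k - v k) ^ 2))
  have hle : |u k - v k| ≤ 0 := by
    refine ge_of_tendsto' hlim fun i => ?_
    have := hgeo (k - i) i
    simp only [sub_add_cancel] at this
    rw [this, abs_mul, abs_of_pos (pow_pos hb0 i)]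
    exact mul_le_mul_of_nonneg_right (abs_le_sqrt_tsum_sq hd _) (pow_pos hb0 i).le
  exact sub_eq_zero.1 (abs_nonpos_iff.1 hle)

lemma cosProdMonoid_countable {P : Polynomial ℤ} {b : ℝ} (hP : HasGeometricKernel P b)
    (hb0 : 0 < b) (hb1 : b < 1) : (cosProdMonoid P : Set ℝ).Countable := by
  have hc : (cosProd '' integralSeqs P).Countable := (integralSeqs_countable hP hb0 hb1).image _
  have : Countable (cosProd '' integralSeqs P) := hc
  have : Countable (FreeMonoid (cosProd '' integralSeqs P)) :=
    inferInstanceAs (Countable (List (cosProd '' integralSeqs P)))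
  rw [cosProdMonoid, Submonoid.closure_eq_mrange, MonoidHom.coe_mrange]
  exact Set.countable_range _

lemma summable_ite_sq {u : ℤ → ℝ} (hu : Summable fun k => u k ^ 2) (p : ℤ → Prop)
    [DecidablePred p] : Summable fun k => if p k then u k ^ 2 else 0 := by
  refine Summable.of_nonneg_of_le (fun k => ?_) (fun k => ?_) hu
  · split_ifs <;> positivity
  · split_ifs
    · exact le_rfl
    · positivity

/-! ### Profile decomposition -/

section Profile

variable {J : Type*}

/-- The no-bubble case. If all entries are at most c, the P-action on k ≥ 0 consists of integers
below 1 in modulus, hence vanishes; the sequence is then geometric from 0 on, and its whole mass is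
controlled by the mass on k ≤ 0, which tends to 0. -/
lemma tendsto_cosProd_one {P : Polynomial ℤ} {b : ℝ} (hP : HasGeometricKernel P b)
    (hb0 : 0 < b) (hb1 : b < 1) {c : ℝ}
    (hc : (∑ i ∈ Finset.range (P.natDegree + 1), |(P.coeff i : ℝ)|) * c < 1)
    {F : Filter J} {w : J → ℤ → ℝ} (hw : ∀ j, Summable fun k => w j k ^ 2)
    (hint : ∀ j k, 0 ≤ k → ∃ m : ℤ, shiftAct P (w j) k = m)
    (htail : Tendsto (fun j => ∑' k : ℤ, if k ≤ 0 then w j k ^ 2 else 0) F (𝓝 0))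
    (hsmall : ∀ᶠ j in F, ∀ k, |w j k| ≤ c) :
    Tendsto (fun j => cosProd (w j)) F (𝓝 1) := by
  have hgs : Summable fun k : ℤ => if 0 ≤ k then (b ^ 2) ^ k.toNat else 0 := by
    refine (Nat.cast_injective (R := ℤ)).summable_iff ?_ |>.1 ?_
    · intro k hk
      rw [if_neg]
      intro h0
      exact hk ⟨k.toNat, by simp [h0]⟩
    · refine (summable_geometric_of_lt_one (r := b ^ 2) (by positivity)
        (by nlinarith)).congr fun n => ?_
      simp
  set G := ∑' k : ℤ, if 0 ≤ k then (b ^ 2) ^ k.toNat else 0 with hG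
  set T : J → ℝ := fun j => ∑' k : ℤ, if k ≤ 0 then w j k ^ 2 else 0 with hT
  have hnorm : ∀ᶠ j in F, |cosProd (w j) - 1| ≤ Real.pi ^ 2 / 2 * (T j + T j * G) := by
    filter_upwards [hsmall] with j hj
    refine (abs_cosProd_sub_one_le (hw j)).trans
      (mul_le_mul_of_nonneg_left ?_ (by positivity))
    have hzero : ∀ k, 0 ≤ k → shiftAct P (w j) k = 0 := by
      intro k hk
      obtain ⟨m, hm⟩ := hint j k hk
      have h1 := (abs_shiftAct_le P (k := k) fun i => hj (k + i)).trans_lt hc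
      rw [hm] at h1 ⊢
      have : m = 0 := Int.abs_lt_one_iff.1 (by exact_mod_cast h1)
      simp [this]
    have hgeo := hP (w j) c 0 hj hzero
    have hts := summable_ite_sq (hw j) (fun k => k ≤ 0)
    have h0 : w j 0 ^ 2 ≤ T j := by
      have := hts.le_tsum 0 fun k _ => by split_ifs <;> positivity
      simpa using this
    rw [hG, hT, ← tsum_mul_left, ← hts.tsum_add (hgs.mul_left _)]
    refine (hw j).tsum_le_tsum (fun k => ?_) (hts.add (hgs.mul_left _))
    rcases le_or_gt k 0 with hk | hk
    · rw [if_pos hk]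
      refine le_add_of_nonneg_right (mul_nonneg ((sq_nonneg _).trans h0) ?_)
      split_ifs <;> positivity
    · rw [if_neg (not_le.2 hk), if_pos hk.le, zero_add]
      have := hgeo k.toNat
      rw [Int.toNat_of_nonneg hk.le, zero_add] at this
      rw [this, mul_pow, ← pow_mul, ← pow_mul, mul_comm 2]
      exact mul_le_mul_of_nonneg_right h0 (by positivity)
  have hlim : Tendsto (fun j => Real.pi ^ 2 / 2 * (T j + T j * G)) F (𝓝 0) := by
    simpa using (htail.add (htail.mul_const G)).const_mul (Real.pi ^ 2 / 2)
  rw [tendsto_iff_dist_tendsto_zero]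
  exact squeeze_zero' (Eventually.of_forall fun _ => dist_nonneg) hnorm hlim

/-- Profile decomposition: along an ultrafilter, a bounded family of half-integral sequences
escaping to infinity has a limiting product of cosines in a fixed countable monoid. -/
theorem exists_tendsto_cosProd {P : Polynomial ℤ} {b : ℝ} (hP : HasGeometricKernel P b)
    (hb0 : 0 < b) (hb1 : b < 1) {c : ℝ} (hc0 : 0 < c)
    (hc : (∑ i ∈ Finset.range (P.natDegree + 1), |(P.coeff i : ℝ)|) * c < 1)
    (F : Ultrafilter J) (n : ℕ) : ∀ w : J → ℤ → ℝ, (∀ j, Summable fun k => w j k ^ 2) →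
      (∀ᶠ j in (F : Filter J), ∑' k, w j k ^ 2 ≤ n * (c ^ 2 / 2)) →
      (∀ j k, 0 ≤ k → ∃ m : ℤ, shiftAct P (w j) k = m) →
      (∀ K : ℤ, Tendsto (fun j => ∑' k : ℤ, if k ≤ K then w j k ^ 2 else 0) F (𝓝 0)) →
      ∃ z ∈ cosProdMonoid P, Tendsto (fun j => cosProd (w j)) F (𝓝 z) := by
  induction n with
  | zero =>
    intro w hw hE hint htail
    refine ⟨1, one_mem _, tendsto_cosProd_one hP hb0 hb1 hc hw hint (htail 0) ?_⟩
    filter_upwards [hE] with j hj k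
    have := (sq_le_tsum_sq (hw j) k).trans hj
    simp only [CharP.cast_eq_zero, zero_mul] at this
    have h0 : w j k = 0 := by nlinarith [sq_nonneg (w j k)]
    simp [h0, hc0.le]
  | succ n ih =>
    intro w hw hE hint htail
    by_cases hsmall : ∀ᶠ j in (F : Filter J), ∀ k, |w j k| ≤ c
    · exact ⟨1, one_mem _, tendsto_cosProd_one hP hb0 hb1 hc hw hint (htail 0) hsmall⟩
    rw [← Ultrafilter.eventually_not] at hsmall
    have hex : ∀ j, ∃ k, (¬ ∀ k, |w j k| ≤ c) → c < |w j k| := by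
      intro j
      by_cases h : ∀ k, |w j k| ≤ c
      · exact ⟨0, fun h' => absurd h h'⟩
      · push Not at h
        obtain ⟨k, hk⟩ := h
        exact ⟨k, fun _ => hk⟩
    choose κ hκ using hex
    have hκc : ∀ᶠ j in (F : Filter J), c < |w j (κ j)| := hsmall.mono fun j hj => hκ j hj
    -- The mass on any half-line k ≤ K tends to 0, so an entry larger than c must lie further and
    -- further right.
    have hκtop : ∀ K : ℤ, ∀ᶠ j in (F : Filter J), K < κ j := by
      intro K
      filter_upwards [hκc, (htail K).eventually_lt_const (show (0 : ℝ) < c ^ 2 by positivity)]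
        with j hj1 hj2
      by_contra hle
      have h1 := (summable_ite_sq (hw j) (fun k => k ≤ K)).le_tsum (κ j)
        fun k _ => by split_ifs <;> positivity
      rw [if_pos (not_lt.1 hle), ← sq_abs] at h1
      nlinarith
    set E : ℝ := ((n + 1 : ℕ) : ℝ) * (c ^ 2 / 2) with hEdef
    set V : J → ℤ → ℝ := fun j k => w j (k + κ j) with hV
    have hVs : ∀ j, Summable fun k => V j k ^ 2 := fun j => summable_sq_translate (hw j) _
    have hVE : ∀ᶠ j in (F : Filter J), ∑' k, V j k ^ 2 ≤ E := by
      filter_upwards [hE] with j hj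
      rwa [hV, tsum_sq_translate]
    have hlimex : ∀ k, ∃ x, Tendsto (fun j => V j k) F (𝓝 x) := fun k =>
      Ultrafilter.exists_tendsto_of_abs_le (C := √E) <| by
        filter_upwards [hVE] with j hj
        exact (abs_le_sqrt_tsum_sq (hVs j) k).trans (Real.sqrt_le_sqrt hj)
    choose v hv using hlimex
    have hvs : Summable fun k => v k ^ 2 := summable_sq_of_tendsto hVs hVE hv
    -- Integrality on k ≥ 0 becomes integrality on k ≥ -κ j after recentring, hence on all of ℤ in
    -- the limit.
    have hvint : v ∈ integralSeqs P := by
      refine ⟨hvs, fun k => exists_int_of_tendsto (tendsto_shiftAct P hv k) ?_⟩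
      filter_upwards [hκtop (-k)] with j hj
      rw [hV, shiftAct_translate]
      exact hint j _ (by omega)
    have hv0 : c ≤ |v 0| := by
      refine ge_of_tendsto (hv 0).abs ?_
      filter_upwards [hκc] with j hj
      simpa [hV] using hj.le
    have hvE : c ^ 2 ≤ ∑' k, v k ^ 2 := by
      refine le_trans ?_ (sq_le_tsum_sq hvs 0)
      rw [← sq_abs (v 0)]
      exact pow_le_pow_left₀ hc0.le hv0 2
    have hDs : ∀ j, Summable fun k => (V j k - v k) ^ 2 := fun j => summable_sq_sub (hVs j) hvs
    have hD0 : ∀ k, Tendsto (fun j => V j k - v k) F (𝓝 0) := fun k => by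
      simpa using (hv k).sub_const (v k)
    have hDE : ∀ᶠ j in (F : Filter J), ∑' k, (V j k - v k) ^ 2 ≤ 2 * E + 2 * ∑' k, v k ^ 2 := by
      filter_upwards [hVE] with j hj
      have h1 : ∑' k, (V j k - v k) ^ 2 ≤ ∑' k, (2 * V j k ^ 2 + 2 * v k ^ 2) :=
        (hDs j).tsum_le_tsum (fun k => by nlinarith [sq_nonneg (V j k + v k)])
          (((hVs j).mul_left 2).add (hvs.mul_left 2))
      rw [((hVs j).mul_left 2).tsum_add (hvs.mul_left 2), tsum_mul_left, tsum_mul_left] at h1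
      linarith
    have hcross := tendsto_tsum_abs_mul hvs hDs hDE hD0
    set w' : J → ℤ → ℝ := fun j k => w j k - v (k + -κ j) with hw'
    have hw'V : ∀ j, (fun k => w' j (k + κ j)) = fun k => V j k - v k := fun j => by
      funext k
      simp [hw', hV]
    have hw's : ∀ j, Summable fun k => w' j k ^ 2 := fun j =>
      summable_sq_sub (hw j) (summable_sq_translate hvs _)
    have key : ∃ z ∈ cosProdMonoid P, Tendsto (fun j => cosProd (w' j)) F (𝓝 z) := by
      refine ih w' hw's ?_ ?_ ?_
      -- The bubble removes mass at least c² and the doubled cross term returns less than c²/2, so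
      -- the budget drops by one unit c²/2.
      · filter_upwards [hVE, hcross.eventually_lt_const (show (0 : ℝ) < c ^ 2 / 4 by positivity)]
          with j hj1 hj2
        have h1 := tsum_sq_sub_le (hVs j) hvs
        have h2 : ∑' k, w' j k ^ 2 = ∑' k, (V j k - v k) ^ 2 := by
          rw [← tsum_sq_translate (w' j) (κ j)]
          exact tsum_congr fun k => by rw [← congrFun (hw'V j) k]
        rw [h2]
        have h3 : E = n * (c ^ 2 / 2) + c ^ 2 / 2 := by
          rw [hEdef]
          push_cast
          ring
        linarith
      · intro j k hk
        obtain ⟨m, hm⟩ := hint j k hk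
        obtain ⟨m', hm'⟩ := hvint.2 (k + -κ j)
        refine ⟨m - m', ?_⟩
        rw [hw', shiftAct_sub, shiftAct_translate, hm, hm']
        push_cast
        ring
      · intro K
        -- The bubble sits near κ j → ∞, so the remainder still escapes to the right.
        have hvtail : Tendsto (fun j => ∑' k : ℤ, if k + κ j ≤ K then v k ^ 2 else 0) F (𝓝 0) := by
          have := tendsto_tsum_of_dominated_convergence (𝓕 := (F : Filter J))
            (f := fun j k => if k + κ j ≤ K then v k ^ 2 else 0) (g := fun _ => (0 : ℝ)) hvs
            (fun k => ?_) (Eventually.of_forall fun j k => ?_)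
          · simpa using this
          · refine tendsto_const_nhds.congr' ?_
            filter_upwards [hκtop (K - k)] with j hj
            rw [if_neg (by omega)]
          · split_ifs
            · simp
            · simpa using sq_nonneg (v k)
        refine squeeze_zero (fun j => tsum_nonneg fun k => by split_ifs <;> positivity) (fun j => ?_)
          (by simpa using ((htail K).const_mul 2).add (hvtail.const_mul 2))
        have hre : (∑' k : ℤ, if k + κ j ≤ K then v k ^ 2 else 0) =
            ∑' k : ℤ, if k ≤ K then v (k + -κ j) ^ 2 else 0 := by
          rw [← (Equiv.addRight (κ j)).tsum_eq fun k => if k ≤ K then v (k + -κ j) ^ 2 else 0]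
          simp
        rw [hre, ← tsum_mul_left, ← tsum_mul_left]
        have hs1 := (summable_ite_sq (hw j) (fun k => k ≤ K)).mul_left 2
        have hs2 := (summable_ite_sq (summable_sq_translate hvs (-κ j)) (fun k => k ≤ K)).mul_left 2
        rw [← hs1.tsum_add hs2]
        refine (summable_ite_sq (hw's j) (fun k => k ≤ K)).tsum_le_tsum (fun k => ?_) (hs1.add hs2)
        split_ifs
        · simp only [hw']
          nlinarith [sq_nonneg (w j k + v (k + -κ j))]
        · simp
    obtain ⟨z, hz, hzlim⟩ := key
    refine ⟨cosProd v * z, mul_mem (Submonoid.subset_closure ⟨v, hvint, rfl⟩) hz, ?_⟩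
    have hdiff : Tendsto (fun j => cosProd (w j) - cosProd v * cosProd (w' j)) F (𝓝 0) := by
      refine squeeze_zero_norm (fun j => ?_)
        (by simpa using hcross.const_mul (Real.pi ^ 2))
      have := abs_cosProd_sub_mul_le (hVs j) hvs
      rwa [← hw'V, cosProd_translate, hV, cosProd_translate] at this
    simpa using hdiff.add (hzlim.const_mul (cosProd v))

end Profile

/-! ### Residues modulo 1 and the countable closure -/

lemma exists_int_polynomial_aeval_inv {θ : ℝ} (hθ : IsPisot θ) {x : ℝ}
    (hx : x ∈ IntermediateField.adjoin ℚ ({θ} : Set ℝ)) :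
    ∃ (p : Polynomial ℤ) (q : ℕ), 0 < q ∧ Polynomial.aeval θ⁻¹ p = q * x := by
  have hint : IsIntegral ℚ θ⁻¹ := (hθ.2.1.tower_top (A := ℚ)).inv
  have hx' : x ∈ IntermediateField.adjoin ℚ ({θ⁻¹} : Set ℝ) := by
    have hle : IntermediateField.adjoin ℚ ({θ} : Set ℝ) ≤
        IntermediateField.adjoin ℚ ({θ⁻¹} : Set ℝ) := by
      rw [IntermediateField.adjoin_simple_le_iff, ← inv_inv θ, inv_inv θ⁻¹]
      exact inv_mem (IntermediateField.mem_adjoin_simple_self ℚ θ⁻¹)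
    exact hle hx
  rw [← IntermediateField.mem_toSubalgebra,
    IntermediateField.adjoin_simple_toSubalgebra_of_isAlgebraic hint.isAlgebraic,
    Algebra.adjoin_singleton_eq_range_aeval] at hx'
  obtain ⟨f, rfl⟩ := hx'
  obtain ⟨b, hb, hP⟩ := IsLocalization.integerNormalization_spec (nonZeroDivisors ℤ) f
  have hb0 : b ≠ 0 := nonZeroDivisors.ne_zero hb
  have h1 : Polynomial.aeval θ⁻¹ (IsLocalization.integerNormalization (nonZeroDivisors ℤ) f) =
      b * Polynomial.aeval θ⁻¹ f := by
    rw [← Polynomial.aeval_map_algebraMap ℚ, hP, map_zsmul, zsmul_eq_mul]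
  -- The sign makes the cleared denominator positive.
  refine ⟨Polynomial.C b.sign * IsLocalization.integerNormalization (nonZeroDivisors ℤ) f,
    b.natAbs, Int.natAbs_pos.2 hb0, ?_⟩
  rw [map_mul, h1, Polynomial.aeval_C, ← mul_assoc]
  congr 1
  have h2 : b.sign * b = (b.natAbs : ℤ) := by
    rw [Int.sign_mul_self_eq_abs, Int.natCast_natAbs]
  calc (algebraMap ℤ ℝ) b.sign * (b : ℝ) = ((b.sign * b : ℤ) : ℝ) := by rw [Int.cast_mul, eq_intCast]
    _ = _ := by rw [h2, Int.cast_natCast]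

lemma abs_cos_pi_mul_le {u : ℝ} (hu : |u| ≤ 1 / 2) :
    |Real.cos (Real.pi * u)| ≤ Real.exp (-(2 * u ^ 2)) := by
  have hpi := Real.pi_pos
  have h1 : |Real.pi * u| ≤ Real.pi / 2 := by
    rw [abs_mul, abs_of_pos hpi]
    nlinarith
  rw [abs_of_nonneg (Real.cos_nonneg_of_mem_Icc (abs_le.1 h1))]
  have h3 : Real.cos (Real.pi * u) ≤ 1 - 2 / Real.pi ^ 2 * (Real.pi * u) ^ 2 :=
    Real.cos_le_one_sub_mul_cos_sq (h1.trans (by linarith))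
  have h4 : 2 / Real.pi ^ 2 * (Real.pi * u) ^ 2 = 2 * u ^ 2 := by
    field_simp
  rw [h4] at h3
  linarith [Real.add_one_le_exp (-(2 * u ^ 2))]

lemma abs_cosProd_le_exp {u : ℤ → ℝ} (hs : Summable fun k => u k ^ 2) (hu : ∀ k, |u k| ≤ 1 / 2) :
    |cosProd u| ≤ Real.exp (-(2 * ∑' k, u k ^ 2)) := by
  refine le_of_tendsto_of_tendsto' (multipliable_cos hs).hasProd.abs
    (Real.continuous_exp.tendsto _ |>.comp (hs.hasSum.const_mul 2).neg) fun s => ?_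
  rw [Function.comp_apply, Finset.mul_sum,
    ← Finset.sum_neg_distrib, Real.exp_sum]
  exact Finset.prod_le_prod (fun _ _ => abs_nonneg _) fun k _ => abs_cos_pi_mul_le (hu k)

lemma shiftAct_congr (p : Polynomial ℤ) {u w : ℤ → ℝ} {k : ℤ}
    (h : ∀ i : ℕ, u (k + i) = w (k + i)) : shiftAct p u k = shiftAct p w k :=
  Finset.sum_congr rfl fun i _ => by rw [h]

lemma Ultrafilter.exists_eventually_eq_of_finite {J α : Type*} (F : Ultrafilter J) {f : J → α}
    {S : Set α} (hS : S.Finite) (h : ∀ j, f j ∈ S) :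
    ∃ a ∈ S, ∀ᶠ j in (F : Filter J), f j = a :=
  (Ultrafilter.eventually_exists_mem_iff hS).1 (Eventually.of_forall fun j => ⟨f j, h j, rfl⟩)

/-- The signed distances of `y b ^ k` to the nearest integers for `k ≥ 0`, extended by zero. -/
noncomputable def geomResidue (b y : ℝ) (k : ℤ) : ℝ :=
  if 0 ≤ k then y * b ^ k.toNat - round (y * b ^ k.toNat) else 0

section Residue

variable {b : ℝ} (y : ℝ)

lemma abs_geomResidue_le_half (k : ℤ) : |geomResidue b y k| ≤ 1 / 2 := by
  rw [geomResidue]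
  split_ifs
  · exact abs_sub_round _
  · norm_num

lemma summable_geomResidue_sq (hb0 : 0 < b) (hb1 : b < 1) :
    Summable fun k => geomResidue b y k ^ 2 := by
  refine (Nat.cast_injective (R := ℤ)).summable_iff ?_ |>.1 ?_
  · intro k hk
    have : ¬ 0 ≤ k := fun h0 => hk ⟨k.toNat, by simp [h0]⟩
    simp [geomResidue, this]
  · refine Summable.of_nonneg_of_le (fun _ => sq_nonneg _) (fun n => ?_)
      ((summable_geometric_of_lt_one (r := b ^ 2) (by positivity) (by nlinarith)).mul_left (y ^ 2))
    have h := round_le (y * b ^ n) 0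
    rw [Int.cast_zero, sub_zero] at h
    simp only [Function.comp_apply, geomResidue, Nat.cast_nonneg, if_true, Int.toNat_natCast]
    rw [← pow_mul, mul_comm 2, pow_mul, ← mul_pow]
    exact sq_le_sq.2 h

lemma exists_int_shiftAct_geomResidue (p : Polynomial ℤ) {k : ℤ} (hk : 0 ≤ k) :
    ∃ m : ℤ, shiftAct p (geomResidue b y) k = y * b ^ k.toNat * Polynomial.aeval b p - m := by
  obtain ⟨m, hm⟩ := exists_int_eq_shiftAct p (fun k => round (y * b ^ k.toNat)) k
  refine ⟨m, ?_⟩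
  rw [← hm, ← shiftAct_geometric (u := fun k => y * b ^ k.toNat) (k := k) (b := b) p,
    ← shiftAct_sub]
  · exact shiftAct_congr p fun i => if_pos (by omega)
  · intro i
    rw [mul_assoc, ← pow_add]
    congr 2
    omega

/-- Squares are taken because subtracting an integer m from the argument multiplies cos(π·) by
(-1)^m. -/
lemma cosProd_geomResidue_tendsto (hb0 : 0 < b) (hb1 : b < 1) :
    Tendsto (fun N => (∏ k ∈ Finset.range N, Real.cos (Real.pi * (y * b ^ k))) ^ 2) atTop
      (𝓝 (cosProd (geomResidue b y) ^ 2)) := by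
  have hs := summable_geomResidue_sq y hb0 hb1
  have hm : Multipliable fun k : ℕ => Real.cos (Real.pi * geomResidue b y k) :=
    multipliable_cos (hs.comp_injective (Nat.cast_injective (R := ℤ)))
  have h1 : ∏' k : ℕ, Real.cos (Real.pi * geomResidue b y k) = cosProd (geomResidue b y) := by
    refine (Nat.cast_injective (R := ℤ)).tprod_eq
      (f := fun k : ℤ => Real.cos (Real.pi * geomResidue b y k)) fun k hk => ?_
    by_contra hk'
    have : ¬ 0 ≤ k := fun h0 => hk' ⟨k.toNat, by simp [h0]⟩
    simp [geomResidue, this] at hk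
  have h2 := hm.hasProd.tendsto_prod_nat.pow 2
  rw [h1] at h2
  refine h2.congr fun N => ?_
  rw [← Finset.prod_pow, ← Finset.prod_pow]
  refine Finset.prod_congr rfl fun k _ => ?_
  simp only [geomResidue, Nat.cast_nonneg, if_true, Int.toNat_natCast]
  rw [mul_sub, mul_comm Real.pi (round (y * b ^ k) : ℝ), Real.cos_sub_int_mul_pi, mul_pow,
    ← sq_abs ((-1 : ℝ) ^ round (y * b ^ k)), abs_zpow, abs_neg, abs_one, one_zpow, one_pow, one_mul]

end Residue

/-- The transform of the Bernoulli convolution as a product of residues, up to sign. -/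
lemma fourierTransform_eq_or_neg {θ : ℝ} (hθ : 1 < θ) (t : ℝ) :
    ∃ s ∈ ({1, -1} : Set ℂ), fourierTransform (bernoulliConvolution θ) t =
      s * cosProd (geomResidue θ⁻¹ (2 * t)) := by
  have h1 := (tendsto_prod_cos_fourierTransform hθ t).pow 2
  have h2 := cosProd_geomResidue_tendsto (b := θ⁻¹) (2 * t) (by positivity)
    (inv_lt_one_of_one_lt₀ hθ)
  have h3 := (Complex.continuous_ofReal.tendsto _).comp h2
  have h4 := tendsto_nhds_unique h1 (a := fourierTransform (bernoulliConvolution θ) t ^ 2)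
    (b := ((cosProd (geomResidue θ⁻¹ (2 * t)) ^ 2 : ℝ) : ℂ)) <| h3.congr fun N => by
      simp only [Function.comp_apply]
      rw [← Complex.ofReal_pow]
      congr 3
      funext k
      ring_nf
  rw [Complex.ofReal_pow] at h4
  rcases sq_eq_sq_iff_eq_or_eq_neg.1 h4 with h | h
  · exact ⟨1, by simp, by rw [h, one_mul]⟩
  · exact ⟨-1, by simp, by rw [h, neg_one_mul]⟩

/-- Sequences supported on the nonnegative half-line on which `P` acts there with integer values,
and on which `p` acts at `0` with an integer value. -/
def halfIntegralSeqs (P p : Polynomial ℤ) : Set (ℤ → ℝ) :=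
  {u | (Summable fun k => u k ^ 2) ∧ (∀ k < 0, u k = 0) ∧
    (∀ k, 0 ≤ k → ∃ m : ℤ, shiftAct P u k = m) ∧ ∃ m : ℤ, shiftAct p u 0 = m}

/-- On a half-line P determines the sequence only up to c·b^k; the value of p at 0 fixes c, since
p(b) ≠ 0. -/
lemma halfIntegralSeqs_countable {P p : Polynomial ℤ} {b : ℝ} (hP : HasGeometricKernel P b)
    (hp : Polynomial.aeval b p ≠ 0) : (halfIntegralSeqs P p).Countable := by
  refine countable_of_shiftAct_int P p {k | 0 ≤ k} _ (fun u hu => hu.1) (fun u hu => hu.2.2.1)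
    (fun u hu => hu.2.2.2) fun u hu v hv huv hp0 => ?_
  have hd := summable_sq_sub hu.1 hv.1
  have hgeo := hP (fun k => u k - v k) _ 0 (abs_le_sqrt_tsum_sq hd) fun k hk => by
    rw [shiftAct_sub, huv k hk, sub_self]
  have h0 := shiftAct_geometric p (u := fun k => u k - v k) hgeo
  rw [shiftAct_sub, hp0, sub_self, eq_comm, mul_eq_zero, or_iff_left hp] at h0
  funext k
  rcases lt_or_ge k 0 with hk | hk
  · rw [hu.2.1 k hk, hv.2.1 k hk]
  · have := hgeo k.toNat
    rw [h0, zero_mul, zero_add, Int.toNat_of_nonneg hk] at this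
    exact sub_eq_zero.1 this

/-- For `γ` in the field of `θ`, the set of translated coefficients has countable closure. -/
theorem countable_closure_translatedCoefficients {θ : ℝ} (hθ : IsPisot θ) {r : ℝ}
    (hr : r ∈ IntermediateField.adjoin ℚ ({θ} : Set ℝ)) (hr0 : r ≠ 0) {γ : ℝ}
    (hγ : γ ∈ IntermediateField.adjoin ℚ ({θ} : Set ℝ)) :
    (closure (translatedCoefficients θ r γ)).Countable := by
  have hθ1 := hθ.1
  have hb0 : 0 < θ⁻¹ := by positivity
  have hb1 : θ⁻¹ < 1 := inv_lt_one_of_one_lt₀ hθ1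
  obtain ⟨P, hPθ, hP⟩ := exists_shiftAct_kernel hθ
  replace hP : HasGeometricKernel P θ⁻¹ := hP
  -- With p(b) = q/r, the action of p at 0 on the residues of 2nr b^k is 2nq minus an integer, so it
  -- is integral. With p'(b) = q'γ/r it is 2nq'γ minus an integer m, which recovers e^{2πiγn} up to
  -- the factor e^{πim/q'}, a 2q'-th root of unity.
  obtain ⟨p, q, hq, hp⟩ := exists_int_polynomial_aeval_inv hθ (inv_mem hr)
  obtain ⟨p', q', hq', hp'⟩ := exists_int_polynomial_aeval_inv hθ (div_mem hγ hr)
  have hq'0 : (q' : ℂ) ≠ 0 := by exact_mod_cast hq'.ne'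
  set S := ∑ i ∈ Finset.range (P.natDegree + 1), |(P.coeff i : ℝ)| with hS
  have hS0 : 0 ≤ S := Finset.sum_nonneg fun _ _ => abs_nonneg _
  set c : ℝ := 1 / (S + 1) with hcdef
  have hc0 : 0 < c := by positivity
  have hc : S * c < 1 := by
    rw [hcdef, mul_one_div, div_lt_one (by positivity)]
    linarith
  set R : Set ℂ := {z | z ^ (2 * q') = 1} with hR
  have hRfin : R.Finite := by
    refine (Polynomial.nthRoots (2 * q') (1 : ℂ)).toFinset.finite_toSet.subset fun z hz => ?_
    rw [Finset.mem_coe, Multiset.mem_toFinset, Polynomial.mem_nthRoots (by omega)]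
    exact hz
  set u : ℤ → ℤ → ℝ := fun n => geomResidue θ⁻¹ (2 * (n * r)) with hu
  have hus : ∀ n, Summable fun k => u n k ^ 2 := fun n => summable_geomResidue_sq _ hb0 hb1
  set f : ℤ → ℂ := fun n => fourierTransform (bernoulliConvolution θ) (n * r) *
      Complex.exp (2 * Real.pi * Complex.I * γ * n) with hf
  set e : (ℤ → ℝ) → ℂ := fun v => Complex.exp (Real.pi * Complex.I * shiftAct p' v 0 / q') with he
  have hform : ∀ n, ∃ s ∈ ({1, -1} : Set ℂ), ∃ ζ ∈ R, f n = s * ζ * (cosProd (u n) * e (u n)) := by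
    intro n
    obtain ⟨s, hs, hsf⟩ := fourierTransform_eq_or_neg hθ1 (n * r)
    obtain ⟨m, hm⟩ := exists_int_shiftAct_geomResidue (b := θ⁻¹) (2 * (n * r)) p' le_rfl
    refine ⟨s, hs, Complex.exp (Real.pi * Complex.I * m / q'), ?_, ?_⟩
    · rw [hR, Set.mem_ofPred_eq, ← Complex.exp_nat_mul, Complex.exp_eq_one_iff]
      refine ⟨m, ?_⟩
      push_cast
      field_simp
    · have hA : shiftAct p' (u n) 0 = 2 * n * q' * γ - m := by
        rw [hu, hm, hp', Int.toNat_zero, pow_zero]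
        field_simp
      have hexp : Complex.exp (2 * Real.pi * Complex.I * γ * n) =
          Complex.exp (Real.pi * Complex.I * m / q') * e (u n) := by
        rw [he]
        simp only
        rw [← Complex.exp_add, hA]
        congr 1
        push_cast
        field_simp
        ring
      rw [hf]
      simp only
      rw [hsf, hexp]
      ring
  choose s hs ζ hζ hfeq using hform
  have hcount : ({0} ∪ (fun x : (ℂ × ℂ) × ((ℤ → ℝ) × ℝ) =>
      x.1.1 * x.1.2 * ((cosProd x.2.1 * x.2.2 : ℝ) * e x.2.1)) ''
      ((({1, -1} : Set ℂ) ×ˢ R) ×ˢ (halfIntegralSeqs P p ×ˢ (cosProdMonoid P : Set ℝ))) :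
        Set ℂ).Countable := by
    refine (Set.countable_singleton _).union (Set.Countable.image ?_ _)
    refine (((Set.toFinite _).countable.prod hRfin.countable)).prod
      ((halfIntegralSeqs_countable hP ?_).prod (cosProdMonoid_countable hP hb0 hb1))
    rw [hp]
    exact mul_ne_zero (by exact_mod_cast hq.ne') (inv_ne_zero hr0)
  refine hcount.mono fun z hz => ?_
  rcases eq_or_ne z 0 with rfl | hz0
  · exact Or.inl rfl
  right
  -- A nonzero point of the closure is a limit along an ultrafilter on the indices n, which need not
  -- tend to infinity.
  have hne : (comap f (𝓝 z)).NeBot := by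
    rw [comap_neBot_iff]
    intro t ht
    obtain ⟨_, hxt, ⟨n, rfl⟩⟩ := mem_closure_iff_nhds.1 hz t ht
    exact ⟨n, hxt⟩
  set F : Ultrafilter ℤ := Ultrafilter.of (comap f (𝓝 z)) with hF
  have hfF : Tendsto f F (𝓝 z) := tendsto_comap.mono_left (Ultrafilter.of_le _)
  obtain ⟨s₀, hs₀, hsF⟩ := F.exists_eventually_eq_of_finite (Set.toFinite _) hs
  obtain ⟨ζ₀, hζ₀, hζF⟩ := F.exists_eventually_eq_of_finite hRfin hζ
  have hnorm : ∀ n, ‖f n‖ ≤ |cosProd (u n)| := by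
    intro n
    obtain ⟨s, hs, hsf⟩ := fourierTransform_eq_or_neg hθ1 (n * r)
    have h1 : ‖s‖ = 1 := by
      rcases hs with rfl | rfl <;> simp
    have h2 : ‖Complex.exp (2 * Real.pi * Complex.I * γ * n)‖ = 1 := by
      rw [show 2 * (Real.pi : ℂ) * Complex.I * γ * n =
        ((2 * Real.pi * γ * n : ℝ) : ℂ) * Complex.I by push_cast; ring]
      exact Complex.norm_exp_ofReal_mul_I _
    rw [hf]
    simp only
    rw [norm_mul, h2, hsf, norm_mul, h1, Complex.norm_real, one_mul, mul_one]
    exact le_rfl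
  -- Obtained by solving ‖z‖/2 < exp(-2 ∑ u_k²) for the sum.
  set E : ℝ := -Real.log (‖z‖ / 2) / 2 with hE
  have hzpos : 0 < ‖z‖ := norm_pos_iff.2 hz0
  have huE : ∀ᶠ n in (F : Filter ℤ), ∑' k, u n k ^ 2 ≤ E := by
    filter_upwards [hfF.norm.eventually_const_lt (half_lt_self hzpos)] with n hn
    have h1 := (hn.trans_le (hnorm n)).trans_le
      (abs_cosProd_le_exp (hus n) (abs_geomResidue_le_half _))
    have h2 := (Real.log_lt_log (by positivity) h1).le
    rw [Real.log_exp] at h2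
    rw [hE]
    linarith
  have hlimex : ∀ k, ∃ x, Tendsto (fun n => u n k) F (𝓝 x) := fun k =>
    Ultrafilter.exists_tendsto_of_abs_le (C := 1 / 2)
      (Eventually.of_forall fun n => abs_geomResidue_le_half _ k)
  choose v hv using hlimex
  have hvs : Summable fun k => v k ^ 2 := summable_sq_of_tendsto hus huE hv
  have hvhalf : ∀ k, |v k| ≤ 1 / 2 := fun k =>
    le_of_tendsto' (hv k).abs fun n => abs_geomResidue_le_half _ k
  have huneg : ∀ n, ∀ k < 0, u n k = 0 := fun n k hk => if_neg (not_le.2 hk)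
  have hvneg : ∀ k < 0, v k = 0 := fun k hk =>
    tendsto_nhds_unique (hv k) (by simp [huneg _ k hk])
  have huint : ∀ n k, 0 ≤ k → ∃ m : ℤ, shiftAct P (u n) k = m := by
    intro n k hk
    obtain ⟨m, hm⟩ := exists_int_shiftAct_geomResidue (b := θ⁻¹) (2 * (n * r)) P hk
    exact ⟨-m, by rw [hu, hm, hPθ]; simp⟩
  have hvint : ∀ k, 0 ≤ k → ∃ m : ℤ, shiftAct P v k = m := fun k hk =>
    exists_int_of_tendsto (tendsto_shiftAct P hv k) (Eventually.of_forall fun n => huint n k hk)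
  have hvp : ∃ m : ℤ, shiftAct p v 0 = m := by
    refine exists_int_of_tendsto (tendsto_shiftAct p hv 0) (Eventually.of_forall fun n => ?_)
    obtain ⟨m, hm⟩ := exists_int_shiftAct_geomResidue (b := θ⁻¹) (2 * (n * r)) p le_rfl
    refine ⟨2 * n * q - m, ?_⟩
    rw [hu, hm, hp, Int.toNat_zero, pow_zero]
    push_cast
    field_simp
  have hDs : ∀ n, Summable fun k => (u n k - v k) ^ 2 := fun n => summable_sq_sub (hus n) hvs
  have hD0 : ∀ k, Tendsto (fun n => u n k - v k) F (𝓝 0) := fun k => by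
    simpa using (hv k).sub_const (v k)
  have hDE : ∀ᶠ n in (F : Filter ℤ), ∑' k, (u n k - v k) ^ 2 ≤ 2 * E + 2 * ∑' k, v k ^ 2 := by
    filter_upwards [huE] with n hn
    have h1 : ∑' k, (u n k - v k) ^ 2 ≤ ∑' k, (2 * u n k ^ 2 + 2 * v k ^ 2) :=
      (hDs n).tsum_le_tsum (fun k => by nlinarith [sq_nonneg (u n k + v k)])
        (((hus n).mul_left 2).add (hvs.mul_left 2))
    rw [((hus n).mul_left 2).tsum_add (hvs.mul_left 2), tsum_mul_left, tsum_mul_left] at h1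
    linarith
  obtain ⟨N, hN⟩ := exists_nat_ge ((2 * E + 2 * ∑' k, v k ^ 2) / (c ^ 2 / 2))
  rw [div_le_iff₀ (by positivity)] at hN
  have key : ∃ x ∈ cosProdMonoid P, Tendsto (fun n => cosProd fun k => u n k - v k) F (𝓝 x) := by
    refine exists_tendsto_cosProd hP hb0 hb1 hc0 hc F N _ hDs (hDE.mono fun n hn => hn.trans hN)
      (fun n k hk => ?_) fun K => ?_
    · obtain ⟨m, hm⟩ := huint n k hk
      obtain ⟨m', hm'⟩ := hvint k hk
      exact ⟨m - m', by rw [shiftAct_sub, hm, hm']; push_cast; rfl⟩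
    -- Both sequences vanish on k < 0, so only the finitely many k in [0, K] matter, each
    -- contributing at most 1.
    · have := tendsto_tsum_of_dominated_convergence (𝓕 := (F : Filter ℤ))
        (f := fun n k => if k ≤ K then (u n k - v k) ^ 2 else 0) (g := fun _ => (0 : ℝ))
        (bound := fun k => if k ∈ Finset.Icc 0 K then 1 else 0) (summable_of_hasFiniteSupport ?_)
        (fun k => ?_) (Eventually.of_forall fun n k => ?_)
      · simpa using this
      · refine (Finset.Icc 0 K).finite_toSet.subset fun k hk => ?_
        by_contra hk'
        exact hk (if_neg hk')
      · split_ifs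
        · simpa using (hD0 k).pow 2
        · exact tendsto_const_nhds
      · rcases lt_or_ge k 0 with hk | hk
        · rw [huneg n k hk, hvneg k hk]
          split_ifs <;> simp
        · by_cases hK : k ≤ K
          · rw [if_pos hK, if_pos (Finset.mem_Icc.2 ⟨hk, hK⟩), Real.norm_eq_abs, abs_pow,
              sq_le_one_iff₀ (abs_nonneg _)]
            refine (abs_sub _ _).trans ?_
            linarith [abs_geomResidue_le_half (b := θ⁻¹) (2 * (n * r)) k, hvhalf k]
          · rw [if_neg hK, norm_zero]
            split_ifs <;> norm_num
  obtain ⟨x, hx, hxlim⟩ := key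
  have hcos : Tendsto (fun n => cosProd (u n)) F (𝓝 (cosProd v * x)) := by
    have hdiff : Tendsto (fun n => cosProd (u n) - cosProd v * cosProd (fun k => u n k - v k)) F
        (𝓝 0) :=
      squeeze_zero_norm (fun n => abs_cosProd_sub_mul_le (hus n) hvs)
        (by simpa using (tendsto_tsum_abs_mul hvs hDs hDE hD0).const_mul (Real.pi ^ 2))
    simpa using hdiff.add (hxlim.const_mul (cosProd v))
  refine ⟨((s₀, ζ₀), (v, x)), ⟨⟨hs₀, hζ₀⟩, ⟨hvs, hvneg, hvint, hvp⟩, hx⟩, ?_⟩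
  refine tendsto_nhds_unique ?_ hfF
  have helim : Tendsto (fun n => e (u n)) F (𝓝 (e v)) := by
    have hce : Continuous fun x : ℝ => Complex.exp (Real.pi * Complex.I * x / q') := by fun_prop
    exact (hce.tendsto _).comp (tendsto_shiftAct p' hv 0)
  have hlim := (((Complex.continuous_ofReal.tendsto _).comp hcos).mul helim).const_mul (s₀ * ζ₀)
  refine hlim.congr' ?_
  filter_upwards [hsF, hζF] with n h1 h2
  rw [hfeq n, h1, h2]
  rfl

/-! ### Arithmetic of Pisot numbers -/

lemma exists_int_eq_of_isIntegral_ratCast {a : ℚ} (h : IsIntegral ℤ (a : ℝ)) : ∃ m : ℤ, a = m := by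
  have h' : IsIntegral ℤ a :=
    (isIntegral_algebraMap_iff (A := ℚ) (B := ℝ) (algebraMap ℚ ℝ).injective).1 h
  obtain ⟨m, hm⟩ := IsIntegrallyClosed.isIntegral_iff.1 h'
  exact ⟨m, by simpa using hm.symm⟩

/-- Multiples of powers of a Pisot number by algebraic integers of its field are exponentially
close to integers. -/
theorem IsPisot.exists_int_abs_sub_le {θ : ℝ} (hθ : IsPisot θ) {x : ℝ}
    (hx : x ∈ IntermediateField.adjoin ℚ ({θ} : Set ℝ)) (hxint : IsIntegral ℤ x) :
    ∃ C l : ℝ, 0 ≤ l ∧ l < 1 ∧ ∀ k : ℕ, ∃ a : ℤ, |x * θ ^ k - a| ≤ C * l ^ k := by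
  classical
  obtain ⟨h1, hint, hconj⟩ := hθ
  set K := IntermediateField.adjoin ℚ ({θ} : Set ℝ) with hK
  have hfd : FiniteDimensional ℚ K :=
    IntermediateField.adjoin.finiteDimensional (hint.tower_top (A := ℚ))
  set T : K := ⟨θ, IntermediateField.mem_adjoin_simple_self ℚ θ⟩ with hT
  set x' : K := ⟨x, hx⟩ with hx'
  have hTint : IsIntegral ℤ T :=
    (isIntegral_algebraMap_iff (A := K) (B := ℝ) (algebraMap K ℝ).injective).1 hint
  have hxint' : IsIntegral ℤ x' :=
    (isIntegral_algebraMap_iff (A := K) (B := ℝ) (algebraMap K ℝ).injective).1 hxint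
  set σ₀ : K →ₐ[ℚ] ℂ := (Complex.ofRealAm.restrictScalars ℚ).comp K.val with hσ₀
  have hσ₀T : σ₀ T = θ := rfl
  have hσ₀x : σ₀ x' = x := rfl
  have hsmall : ∀ σ : K →ₐ[ℚ] ℂ, σ ≠ σ₀ → ‖σ T‖ < 1 := by
    intro σ hσ
    refine hconj _ ?_ fun heq => hσ ?_
    · rw [Polynomial.aeval_algHom_apply]
      have : Polynomial.aeval T (minpoly ℚ θ) = 0 := by
        apply (algebraMap K ℝ).injective
        rw [← Polynomial.aeval_algebraMap_apply, map_zero]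
        exact minpoly.aeval ℚ θ
      rw [this, map_zero]
    · refine IntermediateField.adjoin_algHom_ext ℚ fun y hy => ?_
      rw [Set.mem_singleton_iff] at hy
      subst hy
      exact heq
  set S : Finset (K →ₐ[ℚ] ℂ) := Finset.univ.erase σ₀ with hS
  -- In `NNReal` the supremum over an empty set is 0, so integer θ needs no separate case.
  set l : NNReal := S.sup fun σ => ‖σ T‖₊ with hl
  have hl1 : l < 1 := by
    rw [hl, Finset.sup_lt_iff (by exact zero_lt_one)]
    intro σ hσ
    exact hsmall σ (Finset.ne_of_mem_erase hσ)
  refine ⟨∑ σ ∈ S, ‖σ x'‖, l, l.2, hl1, fun k => ?_⟩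
  -- The nearby integer is the trace of xθ^k; the error is the sum over the other embeddings, where
  -- θ maps into the open disc.
  have htr : IsIntegral ℤ (Algebra.trace ℚ K (x' * T ^ k)) :=
    Algebra.isIntegral_trace (hxint'.mul (hTint.pow k))
  obtain ⟨a, ha⟩ := IsIntegrallyClosed.isIntegral_iff.1 htr
  refine ⟨a, ?_⟩
  have hsum := trace_eq_sum_embeddings ℂ (K := ℚ) (L := K) (x := x' * T ^ k)
  rw [← ha, ← Finset.add_sum_erase _ _ (Finset.mem_univ σ₀)] at hsum
  have heq : ((x * θ ^ k - a : ℝ) : ℂ) = -∑ σ ∈ S, σ (x' * T ^ k) := by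
    have h0 : σ₀ (x' * T ^ k) = x * θ ^ k := by rw [map_mul, map_pow, hσ₀T, hσ₀x]
    rw [h0] at hsum
    push_cast
    rw [hS, eq_neg_iff_add_eq_zero, sub_add_eq_add_sub, ← hsum]
    simp
  rw [← Real.norm_eq_abs, ← Complex.norm_real, heq, norm_neg, Finset.sum_mul]
  refine (norm_sum_le _ _).trans (Finset.sum_le_sum fun σ hσ => ?_)
  rw [map_mul, map_pow, norm_mul, norm_pow]
  have : ‖σ T‖ ≤ l := by
    have := Finset.le_sup (f := fun σ : K →ₐ[ℚ] ℂ => ‖σ T‖₊) hσ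
    exact_mod_cast this
  gcongr

/-- Equality would make the algebraic integer cθ^j half of an odd integer. -/
lemma IsPisot.two_mul_int_mul_pow_ne_odd {θ : ℝ} (hθ : IsPisot θ) (c k : ℤ) (j : ℕ) :
    2 * c * θ ^ j ≠ 2 * k + 1 := by
  intro h
  have hint : IsIntegral ℤ (((2 * k + 1 : ℤ) / 2 : ℚ) : ℝ) := by
    have : (((2 * k + 1 : ℤ) / 2 : ℚ) : ℝ) = (c : ℝ) * θ ^ j := by
      push_cast
      linarith
    rw [this]
    exact (isIntegral_algebraMap (R := ℤ) (x := c)).mul (hθ.2.1.pow j)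
  obtain ⟨m, hm⟩ := exists_int_eq_of_isIntegral_ratCast hint
  rw [div_eq_iff two_ne_zero] at hm
  have : 2 * k + 1 = m * 2 := by exact_mod_cast hm
  omega

/-- All roots of X^M - a have the same modulus, so θ has no other conjugate; it is then a rational
integer exceeding 1. -/
lemma IsPisot.two_le_of_pow_eq_rat {θ : ℝ} (hθ : IsPisot θ) {M : ℕ} (hM : M ≠ 0) {a : ℚ}
    (h : θ ^ M = a) : 2 ≤ θ := by
  obtain ⟨h1, hint, hconj⟩ := hθ
  have hintQ : IsIntegral ℚ θ := hint.tower_top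
  have hroots : ∀ z ∈ ((minpoly ℚ θ).map (algebraMap ℚ ℂ)).roots, z = (θ : ℂ) := by
    intro z hz
    rw [Polynomial.mem_roots (Polynomial.map_ne_zero (minpoly.ne_zero hintQ)),
      Polynomial.IsRoot.def, Polynomial.eval_map_algebraMap] at hz
    by_contra hne
    have hlt := hconj z hz hne
    have hdvd : minpoly ℚ θ ∣ Polynomial.X ^ M - Polynomial.C a :=
      minpoly.dvd _ _ (by simp [h])
    obtain ⟨g, hg⟩ := hdvd
    have h2 : Polynomial.aeval z (Polynomial.X ^ M - Polynomial.C a) = 0 := by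
      rw [hg, map_mul, hz, zero_mul]
    have h3 : z ^ M = ((θ ^ M : ℝ) : ℂ) := by
      rw [h]
      simpa [sub_eq_zero] using h2
    have h4 := congrArg norm h3
    rw [norm_pow, Complex.norm_real, Real.norm_eq_abs, abs_of_pos (by positivity)] at h4
    exact absurd h4 (ne_of_lt (pow_lt_pow_left₀ (hlt.trans h1) (norm_nonneg _) hM))
  have hsep : ((minpoly ℚ θ).map (algebraMap ℚ ℂ)).Separable :=
    (minpoly.irreducible hintQ).separable.map
  have hcard : ((minpoly ℚ θ).map (algebraMap ℚ ℂ)).roots.card ≤ 1 := by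
    rw [← Multiset.toFinset_card_of_nodup (Polynomial.nodup_roots hsep)]
    refine Finset.card_le_one.2 fun x hx y hy => ?_
    rw [Multiset.mem_toFinset] at hx hy
    rw [hroots x hx, hroots y hy]
  rw [← (IsAlgClosed.splits _).natDegree_eq_card_roots, Polynomial.natDegree_map] at hcard
  have hdeg : (minpoly ℚ θ).natDegree = 1 :=
    le_antisymm hcard (minpoly.natDegree_pos hintQ)
  obtain ⟨q, hq⟩ := minpoly.mem_range_of_degree_eq_one ℚ θ
    (by rw [Polynomial.degree_eq_natDegree (minpoly.ne_zero hintQ), hdeg]; rfl)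
  have hq' : (q : ℝ) = θ := by simpa using hq
  rw [← hq'] at hint
  obtain ⟨m, hm⟩ := exists_int_eq_of_isIntegral_ratCast hint
  have hm' : θ = m := by rw [← hq', hm]; simp
  rw [hm'] at h1 ⊢
  have : 1 < m := by exact_mod_cast h1
  exact_mod_cast this

/-- Some `2 ^ s` multiple of a positive integer keeps all cosine factors nonzero. -/
lemma IsPisot.exists_forall_cos_ne_zero {θ : ℝ} (hθ : IsPisot θ) (hθ2 : θ ≠ 2) {N : ℕ}
    (hN : 0 < N) : ∃ s : ℕ, ∀ m : ℤ, Real.cos (Real.pi * (2 * (N * 2 ^ s) * θ ^ m)) ≠ 0 := by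
  by_contra! hcon
  have hθ0 : 0 < θ := by linarith [hθ.1]
  have hodd : ∀ s : ℕ, ∃ m k : ℤ, 4 * (N * 2 ^ s) * θ ^ m = 2 * k + 1 := by
    intro s
    obtain ⟨m, hm⟩ := hcon s
    obtain ⟨k, hk⟩ := Real.cos_eq_zero_iff.1 hm
    refine ⟨m, k, ?_⟩
    have hpi := Real.pi_ne_zero
    field_simp at hk
    linarith
  choose m k hmk using hodd
  have hm0 : m 0 < 0 := by
    by_contra hle
    refine hθ.two_mul_int_mul_pow_ne_odd (2 * N) (k 0) (m 0).toNat ?_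
    rw [← hmk 0, ← zpow_natCast, Int.toNat_of_nonneg (not_lt.1 hle)]
    push_cast
    ring
  -- Otherwise doubling the odd number attached to s and multiplying by a nonnegative power of θ
  -- would again give an odd number.
  have hstep : ∀ s, m (s + 1) < m s := by
    intro s
    by_contra hle
    refine hθ.two_mul_int_mul_pow_ne_odd (2 * k s + 1) (k (s + 1)) (m (s + 1) - m s).toNat ?_
    rw [← zpow_natCast, Int.toNat_of_nonneg (sub_nonneg.2 (not_lt.1 hle)), ← hmk (s + 1)]
    push_cast
    rw [← hmk s, zpow_sub₀ hθ0.ne', pow_succ]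
    field_simp
  have hms : ∀ s : ℕ, m s ≤ -(s + 1 : ℤ) := by
    intro s
    induction s with
    | zero => simpa using Int.le_sub_one_of_lt hm0
    | succ s ih =>
      have := hstep s
      push_cast
      omega
  have hkne : ∀ s, (1 : ℝ) ≤ |2 * (k s : ℝ) + 1| := by
    intro s
    have : (1 : ℤ) ≤ |2 * k s + 1| := Int.one_le_abs (by omega)
    exact_mod_cast this
  rcases lt_or_gt_of_ne hθ2 with hlt | hgt
  -- For θ < 2 a single vanishing factor suffices: it makes a positive power of θ rational.
  · refine absurd (hθ.two_le_of_pow_eq_rat (M := (-m 0).toNat) (a := 4 * N / (2 * k 0 + 1))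
      (by omega) ?_) (not_le.2 hlt)
    have h0 := hmk 0
    have hne : (2 * (k 0 : ℝ) + 1) ≠ 0 := by
      intro h
      have := hkne 0
      rw [h, abs_zero] at this
      linarith
    rw [← zpow_natCast, Int.toNat_of_nonneg (by omega), zpow_neg]
    push_cast
    rw [eq_div_iff hne, ← h0]
    have := zpow_ne_zero (m 0) hθ0.ne'
    field_simp
  -- For θ > 2, the factor 2^s cannot compensate θ^{m s} ≤ θ^{-s}, while an odd integer has modulus
  -- at least 1.
  · have hbound : ∀ s : ℕ, (θ / 2) ^ s ≤ 4 * N := by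
      intro s
      have h1 := hkne s
      rw [← hmk s, abs_of_nonneg (by positivity)] at h1
      have h2 : θ ^ m s ≤ θ ^ (-(s : ℤ)) :=
        zpow_le_zpow_right₀ hθ.1.le ((hms s).trans (by omega))
      rw [zpow_neg, zpow_natCast] at h2
      have h3 : (1 : ℝ) ≤ 4 * (N * 2 ^ s) * (θ ^ s)⁻¹ :=
        h1.trans (mul_le_mul_of_nonneg_left h2 (by positivity))
      rw [← div_eq_mul_inv, le_div_iff₀ (by positivity)] at h3
      rw [div_pow, div_le_iff₀ (by positivity)]
      linarith
    obtain ⟨s, hs⟩ := pow_unbounded_of_one_lt (4 * N : ℝ) (show 1 < θ / 2 by linarith)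
    exact absurd (hbound s) (not_le.2 hs)

/-! ### Coefficients that do not tend to zero -/

lemma abs_cos_pi_mul_sub_int (x : ℝ) (m : ℤ) :
    |Real.cos (Real.pi * (x - m))| = |Real.cos (Real.pi * x)| := by
  rw [mul_sub, mul_comm Real.pi (m : ℝ), Real.cos_sub_int_mul_pi, abs_mul, abs_zpow, abs_neg,
    abs_one, one_zpow, one_mul]

lemma tprod_cos_ne_zero {ι : Type*} {u : ι → ℝ} (hu : Summable fun i => u i ^ 2)
    (h0 : ∀ i, Real.cos (Real.pi * u i) ≠ 0) : ∏' i, Real.cos (Real.pi * u i) ≠ 0 := by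
  have h : Summable fun i => ‖Real.cos (Real.pi * u i) - 1‖ := by
    refine Summable.of_nonneg_of_le (fun _ => norm_nonneg _) (fun i => ?_)
      (hu.mul_left (Real.pi ^ 2 / 2))
    exact (abs_cos_sub_one_le _).trans_eq (by ring)
  simpa using tprod_one_add_ne_zero_of_summable (by simpa using h0) h

lemma fourierTransform_mul {θ : ℝ} (hθ : 1 < θ) (t : ℝ) :
    fourierTransform (bernoulliConvolution θ) (t * θ) =
      Real.cos (Real.pi * (2 * t * θ)) * fourierTransform (bernoulliConvolution θ) t := by
  have h1 := (tendsto_prod_cos_fourierTransform hθ (t * θ)).comp (tendsto_add_atTop_nat 1)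
  have h2 := (tendsto_prod_cos_fourierTransform hθ t).const_mul
    ((Real.cos (Real.pi * (2 * t * θ)) : ℝ) : ℂ)
  refine tendsto_nhds_unique h1 (h2.congr fun N => ?_)
  rw [Function.comp_apply, Finset.prod_range_succ', ← Complex.ofReal_mul, mul_comm]
  congr 2
  · refine Finset.prod_congr rfl fun k _ => ?_
    have : θ ≠ 0 := by positivity
    rw [pow_succ]
    field_simp
  · ring_nf

lemma norm_fourierTransform_mul_pow {θ : ℝ} (hθ : 1 < θ) (t : ℝ) (K : ℕ) :
    ‖fourierTransform (bernoulliConvolution θ) (t * θ ^ K)‖ =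
      (∏ i ∈ Finset.range K, |Real.cos (Real.pi * (2 * t * θ ^ (i + 1)))|) *
        ‖fourierTransform (bernoulliConvolution θ) t‖ := by
  induction K with
  | zero => simp
  | succ K ih =>
    rw [pow_succ, ← mul_assoc, fourierTransform_mul hθ, norm_mul, ih, Finset.prod_range_succ,
      Complex.norm_real, Real.norm_eq_abs]
    ring_nf

/-- This Lipschitz bound allows Mθ^k to be replaced by the nearby integer multiple n_k r. -/
lemma norm_fourierTransform_sub_le {θ : ℝ} (hθ : 1 < θ) (s t : ℝ) :
    ‖fourierTransform (bernoulliConvolution θ) s - fourierTransform (bernoulliConvolution θ) t‖ ≤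
      2 * Real.pi * |s - t| * ∑' k : ℕ, θ⁻¹ ^ k := by
  have hsum : Summable fun k : ℕ => θ⁻¹ ^ k :=
    summable_geometric_of_lt_one (by positivity) (inv_lt_one_of_one_lt₀ hθ)
  refine le_of_tendsto' ((tendsto_prod_cos_fourierTransform hθ s).sub
    (tendsto_prod_cos_fourierTransform hθ t)).norm fun N => ?_
  rw [← Complex.ofReal_sub, Complex.norm_real, Real.norm_eq_abs]
  refine (abs_prod_sub_prod_le (fun _ => Real.abs_cos_le_one _)
    (fun _ => Real.abs_cos_le_one _) _).trans ?_
  have hle : ∀ k ∈ Finset.range N, |Real.cos (2 * Real.pi * s * θ⁻¹ ^ k) -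
      Real.cos (2 * Real.pi * t * θ⁻¹ ^ k)| ≤ 2 * Real.pi * |s - t| * θ⁻¹ ^ k := by
    intro k _
    refine (Real.abs_cos_sub_cos_le _ _).trans_eq ?_
    rw [← sub_mul, ← mul_sub, abs_mul, abs_mul, abs_of_pos Real.two_pi_pos,
      abs_of_nonneg (a := θ⁻¹ ^ k) (by positivity)]
  refine (Finset.sum_le_sum hle).trans ?_
  rw [← Finset.mul_sum]
  exact mul_le_mul_of_nonneg_left (hsum.sum_le_tsum _ fun _ _ => by positivity)
    (by have := Real.pi_pos; positivity)

/-- The transform of the Bernoulli convolution of a Pisot number `θ ≠ 2` has a nonzero limiting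
modulus along the powers of `θ`, up to a suitable integer multiple. -/
theorem IsPisot.exists_tendsto_norm_fourierTransform {θ : ℝ} (hθ : IsPisot θ) (hθ2 : θ ≠ 2)
    {N : ℕ} (hN : 0 < N) : ∃ (M : ℕ) (ρ : ℝ), 0 < M ∧ N ∣ M ∧ 0 < ρ ∧
      Tendsto (fun K : ℕ => ‖fourierTransform (bernoulliConvolution θ) (M * θ ^ K)‖) atTop
        (𝓝 ρ) := by
  have hθ1 := hθ.1
  have hθ0 : 0 < θ := by linarith
  obtain ⟨s, hs⟩ := hθ.exists_forall_cos_ne_zero hθ2 hN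
  set M : ℕ := N * 2 ^ s with hM
  -- Exponents m ≤ 0 give the factors of the transform at M; exponents m > 0 give those gained in
  -- passing from M to Mθ^K.
  have hs' : ∀ m : ℤ, Real.cos (Real.pi * (2 * M * θ ^ m)) ≠ 0 := by
    intro m
    have := hs m
    rw [hM]
    push_cast
    exact this
  have hx : (2 * M * θ : ℝ) ∈ IntermediateField.adjoin ℚ ({θ} : Set ℝ) :=
    mul_mem (mul_mem (ofNat_mem _ 2) (natCast_mem _ M))
      (IntermediateField.mem_adjoin_simple_self ℚ θ)
  have hxint : IsIntegral ℤ (2 * M * θ : ℝ) := by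
    refine IsIntegral.mul ?_ hθ.2.1
    exact_mod_cast isIntegral_algebraMap (R := ℤ) (A := ℝ) (x := ((2 * M : ℕ) : ℤ))
  obtain ⟨C, l, hl0, hl1, happ⟩ := hθ.exists_int_abs_sub_le hx hxint
  choose a ha using happ
  set u : ℕ → ℝ := fun k => 2 * M * θ * θ ^ k - a k with hu
  have hus : Summable fun k => u k ^ 2 := by
    refine Summable.of_nonneg_of_le (fun _ => sq_nonneg _) (fun k => ?_)
      ((summable_geometric_of_lt_one (sq_nonneg l) (by nlinarith)).mul_left (C ^ 2))
    rw [← pow_mul, mul_comm 2, pow_mul, ← mul_pow, ← sq_abs]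
    exact pow_le_pow_left₀ (abs_nonneg _) (ha k) 2
  have hucos : ∀ k, |Real.cos (Real.pi * u k)| = |Real.cos (Real.pi * (2 * M * θ ^ (k + 1)))| := by
    intro k
    rw [hu, abs_cos_pi_mul_sub_int, pow_succ', mul_assoc (2 * (M : ℝ))]
  have hu0 : ∀ k, Real.cos (Real.pi * u k) ≠ 0 := by
    intro k
    rw [← abs_ne_zero, hucos, abs_ne_zero]
    exact_mod_cast hs' (k + 1 : ℕ)
  have hne : fourierTransform (bernoulliConvolution θ) M ≠ 0 := by
    obtain ⟨σ, hσ, hσf⟩ := fourierTransform_eq_or_neg hθ1 M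
    have hσ0 : σ ≠ 0 := by rcases hσ with rfl | rfl <;> simp
    rw [hσf]
    refine mul_ne_zero hσ0 (Complex.ofReal_ne_zero.2 (tprod_cos_ne_zero
      (summable_geomResidue_sq _ (by positivity) (inv_lt_one_of_one_lt₀ hθ1)) fun k => ?_))
    rw [geomResidue]
    split_ifs with hk
    · rw [← abs_ne_zero, abs_cos_pi_mul_sub_int, abs_ne_zero]
      have := hs' (-k)
      rwa [zpow_neg, ← inv_zpow, ← Int.toNat_of_nonneg hk, zpow_natCast] at this
    · simp
  refine ⟨M, |∏' k, Real.cos (Real.pi * u k)| * ‖fourierTransform (bernoulliConvolution θ) M‖,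
    by positivity, ⟨_, rfl⟩, mul_pos (abs_pos.2 (tprod_cos_ne_zero hus hu0)) (norm_pos_iff.2 hne),
    ?_⟩
  refine (((multipliable_cos hus).hasProd.tendsto_prod_nat.abs).mul_const _).congr fun K => ?_
  rw [norm_fourierTransform_mul_pow hθ1, Finset.abs_prod]
  simp_rw [hucos]

/-- For nonzero `r` in the field of a Pisot number `θ ≠ 2` the transform of the Bernoulli
convolution does not vanish along the multiples of `r`. -/
theorem IsPisot.exists_int_tendsto_fourierTransform {θ : ℝ} (hθ : IsPisot θ) (hθ2 : θ ≠ 2)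
    {r : ℝ} (hr : r ∈ IntermediateField.adjoin ℚ ({θ} : Set ℝ)) (hr0 : r ≠ 0) :
    ∃ (n : ℕ → ℤ) (z : ℂ), z ≠ 0 ∧ Tendsto (fun j => |(n j : ℝ)|) atTop atTop ∧
      Tendsto (fun j => fourierTransform (bernoulliConvolution θ) (n j * r)) atTop (𝓝 z) := by
  have hθ1 := hθ.1
  have hralg : IsAlgebraic ℤ r⁻¹ := by
    have hfd : FiniteDimensional ℚ (IntermediateField.adjoin ℚ ({θ} : Set ℝ)) :=
      IntermediateField.adjoin.finiteDimensional (hθ.2.1.tower_top (A := ℚ))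
    have h1 : IsAlgebraic ℚ (⟨r⁻¹, inv_mem hr⟩ : IntermediateField.adjoin ℚ ({θ} : Set ℝ)) :=
      Algebra.IsAlgebraic.isAlgebraic _
    have h2 : IsAlgebraic ℚ r⁻¹ :=
      h1.algHom (IntermediateField.adjoin ℚ ({θ} : Set ℝ)).val
    exact (IsFractionRing.isAlgebraic_iff ℤ ℚ ℝ).2 h2
  obtain ⟨y, hy0, hy⟩ := hralg.exists_integral_multiple
  have hNint : IsIntegral ℤ ((y.natAbs : ℝ) * r⁻¹) := by
    rw [zsmul_eq_mul] at hy
    rcases Int.natAbs_eq y with h | h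
    · rw [h, Int.cast_natCast] at hy
      exact hy
    · rw [h, Int.cast_neg, Int.cast_natCast, neg_mul] at hy
      have := hy.neg
      rwa [neg_neg] at this
  obtain ⟨M, ρ, hM0, ⟨e, hMe⟩, hρ, hlim⟩ :=
    hθ.exists_tendsto_norm_fourierTransform hθ2 (Int.natAbs_pos.2 hy0)
  have hxint : IsIntegral ℤ ((M : ℝ) * r⁻¹) := by
    rw [hMe]
    push_cast
    rw [mul_right_comm]
    refine hNint.mul ?_
    exact_mod_cast isIntegral_algebraMap (R := ℤ) (A := ℝ) (x := (e : ℤ))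
  obtain ⟨C, l, hl0, hl1, happ⟩ := hθ.exists_int_abs_sub_le
    (mul_mem (natCast_mem _ M) (inv_mem hr)) hxint
  choose n hn using happ
  have herr : Tendsto (fun k => (M : ℝ) * r⁻¹ * θ ^ k - n k) atTop (𝓝 0) :=
    squeeze_zero_norm hn
      (by simpa using (tendsto_pow_atTop_nhds_zero_of_lt_one hl0 hl1).const_mul C)
  have hntop : Tendsto (fun j => |(n j : ℝ)|) atTop atTop := by
    have hMr : 0 < |(M : ℝ) * r⁻¹| := abs_pos.2 (mul_ne_zero (by positivity) (inv_ne_zero hr0))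
    have h1 : Tendsto (fun k : ℕ => |(M : ℝ) * r⁻¹| * θ ^ k + -|(M : ℝ) * r⁻¹ * θ ^ k - n k|) atTop
        atTop :=
      ((tendsto_pow_atTop_atTop_of_one_lt hθ1).const_mul_atTop hMr).atTop_add herr.abs.neg
    refine tendsto_atTop_mono (fun k => ?_) h1
    have h2 := abs_sub_abs_le_abs_sub ((M : ℝ) * r⁻¹ * θ ^ k) (n k)
    rw [abs_mul _ (θ ^ k), abs_of_nonneg (a := θ ^ k) (by positivity)] at h2
    linarith
  set g : ℕ → ℂ := fun k => fourierTransform (bernoulliConvolution θ) (n k * r) with hg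
  have hdiff : Tendsto (fun k => g k - fourierTransform (bernoulliConvolution θ) (M * θ ^ k)) atTop
      (𝓝 0) := by
    refine squeeze_zero_norm (fun k => norm_fourierTransform_sub_le hθ1 _ _) ?_
    have h1 : Tendsto (fun k => (n k : ℝ) * r - M * θ ^ k) atTop (𝓝 0) := by
      have := (herr.neg).mul_const r
      rw [neg_zero, zero_mul] at this
      refine this.congr fun k => ?_
      field_simp
      ring
    simpa using ((h1.abs).const_mul (2 * Real.pi)).mul_const (∑' k : ℕ, θ⁻¹ ^ k)
  have hgnorm : Tendsto (fun k => ‖g k‖) atTop (𝓝 ρ) := by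
    have h1 : Tendsto (fun k => ‖g k‖ - ‖fourierTransform (bernoulliConvolution θ) (M * θ ^ k)‖)
        atTop (𝓝 0) :=
      squeeze_zero_norm (fun k => abs_norm_sub_norm_le _ _) (by simpa using hdiff.norm)
    simpa using h1.add hlim
  obtain ⟨B, hB⟩ := hgnorm.bddAbove_range
  -- Only the moduli are known to converge; compactness yields a subsequence along which the values
  -- do.
  obtain ⟨z, -, φ, hφ, hz⟩ := tendsto_subseq_of_bounded (Metric.isBounded_closedBall (x := (0 : ℂ))
    (r := B)) (fun k => by simpa using hB ⟨k, rfl⟩ : ∀ k, g k ∈ Metric.closedBall (0 : ℂ) B)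
  refine ⟨n ∘ φ, z, ?_, hntop.comp hφ.tendsto_atTop, hz⟩
  rw [← norm_ne_zero_iff, tendsto_nhds_unique hz.norm (hgnorm.comp hφ.tendsto_atTop)]
  exact hρ.ne'

/-! ### Accumulation of phases for almost every γ -/

/-- The Riemann–Lebesgue lemma for the indicator of a set. -/
lemma tendsto_setIntegral_exp_cocompact {B : Set ℝ} (hB : MeasurableSet B) :
    Tendsto (fun t : ℝ => ∫ x in B, Complex.exp (2 * Real.pi * Complex.I * x * t))
      (cocompact ℝ) (𝓝 0) := by
  have h := (Real.tendsto_integral_exp_smul_cocompact (B.indicator fun _ => (1 : ℂ))).comp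
    (Homeomorph.neg ℝ).isClosedEmbedding.tendsto_cocompact
  refine h.congr fun t => ?_
  rw [← integral_indicator hB]
  refine integral_congr_ae (Eventually.of_forall fun x => ?_)
  by_cases hx : x ∈ B
  · simp only [Set.indicator_of_mem hx, Circle.smul_def, Real.fourierChar_apply, Homeomorph.coe_neg,
      smul_eq_mul, mul_one]
    congr 1
    push_cast
    ring
  · simp [Set.indicator_of_notMem hx]

/-- The polynomial `((1 + Re ζ) / 2) ^ M` on the unit circle, as a Laurent polynomial. -/
lemma sum_centered_binomial {ζ : ℂ} (hζ : ‖ζ‖ = 1) (M : ℕ) :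
    ∑ i ∈ Finset.range (2 * M + 1), ((2 * M).choose i / 4 ^ M : ℂ) * ζ ^ ((i : ℤ) - M) =
      (((1 - ‖ζ - 1‖ ^ 2 / 4) ^ M : ℝ) : ℂ) := by
  have hζ0 : ζ ≠ 0 := norm_ne_zero_iff.1 (by rw [hζ]; exact one_ne_zero)
  have hinv : ζ⁻¹ = (starRingEnd ℂ) ζ := by
    rw [Complex.inv_def, Complex.normSq_eq_norm_sq, hζ]
    simp
  have h1 : ((‖ζ - 1‖ ^ 2 : ℝ) : ℂ) = 2 - ζ - ζ⁻¹ := by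
    rw [← Complex.normSq_eq_norm_sq, ← Complex.mul_conj, map_sub, map_one, ← hinv]
    field_simp
    ring
  have h2 : (((1 - ‖ζ - 1‖ ^ 2 / 4 : ℝ)) : ℂ) = (ζ + 1) ^ 2 / (4 * ζ) := by
    rw [Complex.ofReal_sub, Complex.ofReal_div, h1]
    push_cast
    field_simp
    ring
  rw [Complex.ofReal_pow, h2, div_pow, ← pow_mul, add_pow, Finset.sum_div]
  refine Finset.sum_congr rfl fun i _ => ?_
  rw [zpow_sub₀ hζ0, zpow_natCast, zpow_natCast, one_pow, mul_one, mul_pow]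
  field_simp

/-- The kernel ((1 + Re ζ)/2)^M, with ζ the phase divided by w, is at most q^M on B, where q < 1. By
Riemann–Lebesgue its integral over B tends to |B| times its mean binom(2M, M)/4^M, which decays only
polynomially in M. Large M forces |B| = 0. -/
lemma measure_eq_zero_of_forall_le_norm_sub {n : ℕ → ℤ}
    (hn : Tendsto (fun j => |(n j : ℝ)|) atTop atTop) {w : ℂ} (hw : ‖w‖ = 1) {ε : ℝ}
    (hε : 0 < ε) (hε1 : ε ≤ 1) {B : Set ℝ} (hB : MeasurableSet B) (hBfin : volume B ≠ ∞)
    (h : ∀ᶠ j in atTop, ∀ γ ∈ B, ε ≤ ‖Complex.exp (2 * Real.pi * Complex.I * γ * n j) - w‖) :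
    volume B = 0 := by
  have hw0 : w ≠ 0 := norm_ne_zero_iff.1 (by rw [hw]; exact one_ne_zero)
  set q : ℝ := 1 - ε ^ 2 / 4 with hq
  have hq0 : 0 ≤ q := by nlinarith
  have hq1 : q < 1 := by
    have : 0 < ε ^ 2 := by positivity
    linarith
  set m : ℝ := volume.real B with hm
  have hunit : ∀ (γ : ℝ) (j : ℕ), ‖Complex.exp (2 * Real.pi * Complex.I * γ * n j)‖ = 1 := by
    intro γ j
    rw [show 2 * (Real.pi : ℂ) * Complex.I * γ * n j =
      ((2 * Real.pi * γ * n j : ℝ) : ℂ) * Complex.I by push_cast; ring]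
    exact Complex.norm_exp_ofReal_mul_I _
  have hbound : ∀ M : ℕ, m * ((2 * M).choose M / 4 ^ M) ≤ m * q ^ M := by
    intro M
    set ζ : ℕ → ℝ → ℂ := fun j γ => Complex.exp (2 * Real.pi * Complex.I * γ * n j) * w⁻¹ with hζ
    have hζ1 : ∀ j γ, ‖ζ j γ‖ = 1 := fun j γ => by
      rw [hζ]
      simp only
      rw [norm_mul, hunit, norm_inv, hw, inv_one, one_mul]
    have hterm : ∀ (i : ℕ) (j : ℕ) (γ : ℝ), ζ j γ ^ ((i : ℤ) - M) =
        w⁻¹ ^ ((i : ℤ) - M) * Complex.exp (2 * Real.pi * Complex.I * γ *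
          ((n j * ((i : ℤ) - M) : ℝ) : ℂ)) := by
      intro i j γ
      rw [hζ]
      simp only
      rw [mul_zpow, ← Complex.exp_int_mul, mul_comm]
      congr 2
      push_cast
      ring
    have hcont : ∀ t : ℝ, Continuous fun γ : ℝ =>
        Complex.exp (2 * Real.pi * Complex.I * γ * t) := fun t => by fun_prop
    have hint : ∀ t : ℝ, IntegrableOn
        (fun γ : ℝ => Complex.exp (2 * Real.pi * Complex.I * γ * t)) B := fun t => by
      refine Measure.integrableOn_of_bounded (M := 1) hBfin (hcont t).aestronglyMeasurable ?_
      refine Eventually.of_forall fun γ => le_of_eq ?_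
      rw [show 2 * (Real.pi : ℂ) * Complex.I * γ * t =
        ((2 * Real.pi * γ * t : ℝ) : ℂ) * Complex.I by push_cast; ring]
      exact Complex.norm_exp_ofReal_mul_I _
    have hlim : Tendsto (fun j => ∫ γ in B,
        (((1 - ‖ζ j γ - 1‖ ^ 2 / 4) ^ M : ℝ) : ℂ)) atTop
        (𝓝 (m * ((2 * M).choose M / 4 ^ M : ℂ))) := by
      have heq : ∀ j, ∫ γ in B, (((1 - ‖ζ j γ - 1‖ ^ 2 / 4) ^ M : ℝ) : ℂ) =
          ∑ i ∈ Finset.range (2 * M + 1), ((2 * M).choose i / 4 ^ M : ℂ) *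
            (w⁻¹ ^ ((i : ℤ) - M) * ∫ γ in B, Complex.exp (2 * Real.pi * Complex.I * γ *
              ((n j * ((i : ℤ) - M) : ℝ) : ℂ))) := by
        intro j
        simp_rw [← sum_centered_binomial (hζ1 j _), hterm]
        rw [integral_finsetSum _ fun i _ => ((hint _).const_mul _).const_mul _]
        refine Finset.sum_congr rfl fun i _ => ?_
        rw [integral_const_mul, integral_const_mul]
      simp_rw [heq]
      have htarget : (m * ((2 * M).choose M / 4 ^ M) : ℂ) =
          ∑ i ∈ Finset.range (2 * M + 1), if i = M then
            (m * ((2 * M).choose M / 4 ^ M) : ℂ) else 0 := by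
        rw [Finset.sum_ite_eq', if_pos (Finset.mem_range.2 (by omega))]
      rw [htarget]
      -- Only the constant term i = M survives; every other frequency n_j(i - M) goes to infinity.
      refine tendsto_finsetSum _ fun i _ => ?_
      split_ifs with hi
      · subst hi
        refine tendsto_const_nhds.congr fun j => ?_
        simp [hm, mul_comm]
      · have hne : ((i : ℤ) - M : ℝ) ≠ 0 := by
          rw [Int.cast_natCast, sub_ne_zero]
          exact_mod_cast hi
        have ht : Tendsto (fun j => (n j * ((i : ℤ) - M) : ℝ)) atTop (cocompact ℝ) := by
          rw [← Metric.cobounded_eq_cocompact, ← tendsto_norm_atTop_iff_cobounded]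
          simp only [norm_mul]
          exact hn.atTop_mul_const (norm_pos_iff.2 hne)
        have := (((tendsto_setIntegral_exp_cocompact hB).comp ht).const_mul
          (w⁻¹ ^ ((i : ℤ) - M))).const_mul ((2 * M).choose i / 4 ^ M : ℂ)
        simpa using this
    have hle : ∀ᶠ j in atTop, ‖∫ γ in B, (((1 - ‖ζ j γ - 1‖ ^ 2 / 4) ^ M : ℝ) : ℂ)‖ ≤
        m * q ^ M := by
      filter_upwards [h] with j hj
      rw [mul_comm]
      refine norm_setIntegral_le_of_norm_le_const hBfin.lt_top fun γ hγ => ?_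
      have h1 : ‖ζ j γ - 1‖ = ‖Complex.exp (2 * Real.pi * Complex.I * γ * n j) - w‖ := by
        rw [hζ]
        simp only
        rw [← mul_inv_cancel₀ hw0, ← sub_mul, norm_mul, norm_inv, hw, inv_one, mul_one]
      have h2 : ‖ζ j γ - 1‖ ≤ 2 := by
        refine (norm_sub_le _ _).trans ?_
        rw [hζ1, norm_one]
        norm_num
      have h3 := hj γ hγ
      rw [← h1] at h3
      rw [Complex.norm_real, Real.norm_eq_abs, abs_pow]
      refine pow_le_pow_left₀ (abs_nonneg _) ?_ M
      rw [abs_of_nonneg (by nlinarith [norm_nonneg (ζ j γ - 1)])]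
      nlinarith
    have hfinal := le_of_tendsto hlim.norm hle
    rwa [show (m * ((2 * M).choose M / 4 ^ M : ℂ)) =
      ((m * ((2 * M).choose M / 4 ^ M) : ℝ) : ℂ) by push_cast; rfl, Complex.norm_real,
      Real.norm_eq_abs, abs_of_nonneg (by positivity)] at hfinal
  by_contra hne
  have hmpos : 0 < m := ENNReal.toReal_pos hne hBfin
  have hge : ∀ M : ℕ, 0 < M → 1 ≤ 2 * (M * q ^ M) := by
    intro M hM
    have h1 := le_of_mul_le_mul_left (hbound M) hmpos
    have h2 : (4 : ℝ) ^ M ≤ 2 * M * (2 * M).choose M := by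
      exact_mod_cast Nat.four_pow_le_two_mul_self_mul_centralBinom M hM
    rw [div_le_iff₀ (by positivity)] at h1
    have h3 : (4 : ℝ) ^ M ≤ 4 ^ M * (2 * (M * q ^ M)) :=
      h2.trans (by nlinarith [mul_le_mul_of_nonneg_left h1 (show (0 : ℝ) ≤ 2 * M by positivity)])
    exact (le_mul_iff_one_le_right (by positivity)).1 h3
  have hzero := (tendsto_self_mul_const_pow_of_lt_one hq0 hq1).const_mul 2
  rw [mul_zero] at hzero
  have := ge_of_tendsto hzero ((eventually_gt_atTop 0).mono hge)
  linarith

/-- For almost every `γ` and integers `n j` with `|n j| → ∞`, the sequence `e^{2π i γ n j}`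
accumulates at every point of the unit circle. -/
theorem ae_forall_mapClusterPt_exp {n : ℕ → ℤ}
    (hn : Tendsto (fun j => |(n j : ℝ)|) atTop atTop) :
    ∀ᵐ γ : ℝ, ∀ w : ℂ, ‖w‖ = 1 →
      MapClusterPt w atTop fun j => Complex.exp (2 * Real.pi * Complex.I * γ * n j) := by
  have hnull : ∀ (w : Circle) (k J : ℕ), ∀ᵐ γ : ℝ, ∃ j ≥ J,
      ‖Complex.exp (2 * Real.pi * Complex.I * γ * n j) - w‖ < 1 / (k + 1 : ℝ) := by
    intro w k J
    rw [ae_iff]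
    push Not
    set B : Set ℝ := {γ : ℝ | ∀ j ≥ J, 1 / (k + 1 : ℝ) ≤
      ‖Complex.exp (2 * Real.pi * Complex.I * γ * n j) - w‖} with hB
    have hBclosed : IsClosed B := by
      simp only [hB, Set.ofPred_forall]
      exact isClosed_iInter fun j => isClosed_iInter fun _ =>
        isClosed_le continuous_const (by fun_prop)
    have hcover : B ⊆ ⋃ R : ℕ, B ∩ Set.Icc (-R : ℝ) R := by
      intro γ hγ
      obtain ⟨R, hR⟩ := exists_nat_ge |γ|
      exact Set.mem_iUnion.2 ⟨R, hγ, abs_le.1 hR⟩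
    refine measure_mono_null hcover (measure_iUnion_null fun R => ?_)
    refine measure_eq_zero_of_forall_le_norm_sub hn (Circle.norm_coe w)
      (ε := 1 / (k + 1 : ℝ))
      (by positivity) ?_ (hBclosed.measurableSet.inter measurableSet_Icc) ?_ ?_
    · rw [div_le_one (by positivity)]
      linarith [k.cast_nonneg (α := ℝ)]
    · exact ((measure_mono Set.inter_subset_right).trans_lt measure_Icc_lt_top).ne
    · filter_upwards [eventually_ge_atTop J] with j hj γ hγ
      exact hγ.1 j hj
  -- A countable dense set of targets keeps the union of exceptional sets null; density then reaches
  -- every w for the same γ.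
  obtain ⟨D, hDc, hDd⟩ := TopologicalSpace.exists_countable_dense Circle
  have hall : ∀ᵐ γ : ℝ, ∀ w ∈ D, ∀ k J : ℕ, ∃ j ≥ J,
      ‖Complex.exp (2 * Real.pi * Complex.I * γ * n j) - w‖ < 1 / (k + 1 : ℝ) := by
    rw [ae_ball_iff hDc]
    exact fun w _ => ae_all_iff.2 fun k => ae_all_iff.2 fun J => hnull w k J
  filter_upwards [hall] with γ hγ w hw
  rw [mapClusterPt_iff_frequently]
  intro s hs
  obtain ⟨ε, hε, hball⟩ := Metric.mem_nhds_iff.1 hs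
  obtain ⟨k, hk⟩ := exists_nat_one_div_lt (half_pos hε)
  obtain ⟨d, hdD, hd⟩ := hDd.exists_dist_lt (⟨w, mem_sphere_zero_iff_norm.2 hw⟩ : Circle)
    (half_pos hε)
  rw [frequently_atTop]
  intro J
  obtain ⟨j, hj, hlt⟩ := hγ d hdD k J
  refine ⟨j, hj, hball ?_⟩
  rw [Metric.mem_ball]
  have h1 : dist (d : ℂ) w < ε / 2 := by
    rw [dist_comm]
    exact hd
  have h2 := dist_triangle (Complex.exp (2 * Real.pi * Complex.I * γ * n j)) d w
  rw [dist_eq_norm _ (d : ℂ)] at h2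
  linarith

/-! ### The circle in the closure -/

lemma not_countable_sphere {ρ : ℝ} (hρ : 0 < ρ) : ¬ (Metric.sphere (0 : ℂ) ρ).Countable := by
  intro h
  have h1 : (Set.Icc 0 ρ).Countable := by
    refine (h.image Complex.re).mono fun t ht => ?_
    refine ⟨⟨t, √(ρ ^ 2 - t ^ 2)⟩, ?_, rfl⟩
    have h0 : 0 ≤ ρ ^ 2 - t ^ 2 := by nlinarith [ht.1, ht.2]
    rw [mem_sphere_zero_iff_norm, Complex.norm_def, Complex.normSq_mk, Real.mul_self_sqrt h0,
      show t * t + (ρ ^ 2 - t ^ 2) = ρ ^ 2 by ring, Real.sqrt_sq hρ.le]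
  have h2 := h1.le_aleph0
  rw [Cardinal.mk_Icc_real hρ] at h2
  exact absurd h2 (not_le.2 Cardinal.aleph0_lt_continuum)

theorem mainTheorem5 (θ : ℝ) (hθ : IsPisot θ) (hθ2 : θ ≠ 2)
    (r : ℝ) (hr : r ∈ IntermediateField.adjoin ℚ ({θ} : Set ℝ)) (hr0 : r ≠ 0) :
    (∀ γ ∈ IntermediateField.adjoin ℚ ({θ} : Set ℝ),
      (closure (translatedCoefficients θ r γ)).Countable) ∧
    ∃ ρ : ℝ, 0 < ρ ∧ ∀ᵐ γ : ℝ,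
      Metric.sphere (0 : ℂ) ρ ⊆ closure (translatedCoefficients θ r γ) ∧
        ¬ (closure (translatedCoefficients θ r γ)).Countable := by
  refine ⟨fun γ hγ => countable_closure_translatedCoefficients hθ hr hr0 hγ, ?_⟩
  obtain ⟨n, z, hz0, hntop, hz⟩ := hθ.exists_int_tendsto_fourierTransform hθ2 hr hr0
  have hzpos : 0 < ‖z‖ := norm_pos_iff.2 hz0
  refine ⟨‖z‖, hzpos, ?_⟩
  filter_upwards [ae_forall_mapClusterPt_exp hntop] with γ hγ
  have hsub : Metric.sphere (0 : ℂ) ‖z‖ ⊆ closure (translatedCoefficients θ r γ) := by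
    intro y hy
    rw [mem_sphere_zero_iff_norm] at hy
    have hyz : ‖y / z‖ = 1 := by rw [norm_div, hy, div_self hzpos.ne']
    -- Along U the phases tend to y/z while the coefficients still tend to z, so the products tend
    -- to y.
    obtain ⟨U, hU, hlim⟩ := mapClusterPt_iff_ultrafilter.1 (hγ (y / z) hyz)
    have hprod := (hz.mono_left hU).mul hlim
    rw [mul_div_cancel₀ _ hz0] at hprod
    refine mem_closure_of_tendsto hprod (Eventually.of_forall fun j => ⟨n j, rfl⟩)
  exact ⟨hsub, fun hc => not_countable_sphere hzpos (hc.mono hsub)⟩
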